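/- There is a function $f\colon\mathbb{N}\to\mathbb{N}$ such that for all natural numbers $t$ and $\ell$ the following holds. Let $G$ be a finite simple graph that is $C_{\geq t}$-free, i.e., no induced subgraph of $G$ is a cycle with at least $t$ vertices (where cycles have at least three vertices), and that does not contain the complete bipartite graph $K_{\ell,\ell}$ as a (not necessarily induced) subgraph. Then the chromatic number of $G$ satisfies $\chi(G)\leq \ell^{f(t)}+1$. -/

import Mathlib

/-- `G` is `C_{≥t}`-free: no cycle with at least `t` vertices is an induced subgraph of `G`.
A cycle has at least three vertices. -/
def SimpleGraph.CycleGEFree {V : Type*} (G : SimpleGraph V) (t : ℕ) : Prop :=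
  ∀ n : ℕ, 3 ≤ n → t ≤ n → ¬ (SimpleGraph.cycleGraph n).IsIndContained G

/-!
The graph is shown to have degeneracy polynomial in `ℓ`; colouring greedily then gives the bound.
All densities are measured by `adjPairs`, the number of adjacent ordered pairs in a finite set. The
argument looks for an induced cycle `b₀ a₀ b₁ a₁ …` in which the `aᵢ` have degree two, that is, for
an induced subdivision of a long cycle (`isIndContained_of_alternating`).

*Dense sets.* A set `W` that spans a fraction `1 / Λ` of its pairs, where `|W|` exceeds a fixed power
of `Λ` and there is no `K_{Λ,Λ}`, contains such a cycle
(`NoBiclique.isIndContained_of_dense`). By dependent random choice there is a large `B ⊆ W` in which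
almost all pairs have many common neighbours; as fewer than `Λ` vertices are adjacent to almost all
of a given large set, adjacency between two sets can be avoided at the cost of a factor `O(Λ)`, and a
counting argument produces independent `bᵢ ∈ B` and then the `aᵢ`. Hence moderately large sets
span few edges.

*Sparse graphs.* Take a subgraph of maximal average degree `D`; the graph is then `D`-degenerate.
Suppose that there are sets `A` and `B` such that each vertex of `A` has about `D` neighbours in `B`.
A cherry system is a set of pairs of nonadjacent vertices of `B`, each with a common neighbour in `A`
assigned to it. By maximality of a cherry system and by sparsity of moderately large sets there are
systems with far more than `D |B₀|` members on some `B₀ ⊆ B` (`exists_isCherrySystem`). A random subset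
`S` of `B₀` of density about `1 / D`, up to a power of `ℓ`, then isolates more than `t |S|` members
whose centres see nothing else in `S`; degeneracy makes end points and centres independent after few deletions. This is an
induced subdivision of a graph of large average degree on `S`
(`IsCherrySystem.isIndContained_of_sample`), which has a long cycle.

Suitable sets `A` and `B` come from the vertices whose degree exceeds `D` by a large factor. If the
others span half of the edges, these serve as `A` and `B`, and sparsity of neighbourhoods limits the
conflicts between adjacent centres that share an end point. Otherwise `B` consists of the
high-degree vertices, and its small size compensates for such conflicts
(`exists_long_cycle_of_densest`).
-/

/-! ### Finite relations, induced cycles and degeneracy -/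

open scoped Classical in
/-- The neighbours of `v` under the relation `R` inside the finite set `W`. -/
noncomputable def relNbrs {V : Type*} (R : V → V → Prop) (W : Finset V) (v : V) : Finset V :=
  W.filter (R v)

theorem mem_relNbrs {V : Type*} {R : V → V → Prop} {W : Finset V} {v x : V} :
    x ∈ relNbrs R W v ↔ x ∈ W ∧ R v x := by
  simp [relNbrs]

theorem relNbrs_subset {V : Type*} (R : V → V → Prop) (W : Finset V) (v : V) :
    relNbrs R W v ⊆ W := fun _ h => (mem_relNbrs.1 h).1

theorem relNbrs_mono {V : Type*} (R : V → V → Prop) {W W' : Finset V} (h : W ⊆ W') (v : V) :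
    relNbrs R W v ⊆ relNbrs R W' v := fun _ hx =>
  mem_relNbrs.2 ⟨h (mem_relNbrs.1 hx).1, (mem_relNbrs.1 hx).2⟩

theorem cycleGraph_adj_iff_val {n : ℕ} (u v : Fin n) :
    (SimpleGraph.cycleGraph n).Adj u v ↔ n ≠ 1 ∧
      (u.val + 1 = v.val ∨ v.val + 1 = u.val ∨ (u.val = 0 ∧ v.val + 1 = n) ∨
        (v.val = 0 ∧ u.val + 1 = n)) := by
  rw [SimpleGraph.cycleGraph_adj', Fin.val_sub, Fin.val_sub]
  have hu := u.isLt
  have hv := v.isLt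
  have key : ∀ a b : ℕ, a < n → b < n → ((n - b + a) % n = if b ≤ a then a - b else n - b + a) := by
    intro a b ha hb
    split_ifs with h
    · have : n - b + a = (a - b) + n := by omega
      rw [this, Nat.add_mod_right, Nat.mod_eq_of_lt (by omega)]
    · exact Nat.mod_eq_of_lt (by omega)
  rw [key _ _ hu hv, key _ _ hv hu]
  split_ifs <;> omega

/-- An alternating cyclic sequence `b 0, a 0, b 1, a 1, …` in which the `b i` are pairwise
nonadjacent, the `a i` are pairwise nonadjacent and `a i` sees exactly `b i` and its cyclic
successor is an induced cycle. -/
theorem isIndContained_of_alternating {V : Type*} {G : SimpleGraph V} {n : ℕ} (hn : 3 ≤ n)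
    (a b : ℕ → V) (hb : ∀ i < n, ∀ j < n, ¬ G.Adj (b i) (b j))
    (ha : ∀ i < n, ∀ j < n, ¬ G.Adj (a i) (a j))
    (hab : ∀ i < n, ∀ j < n, G.Adj (a i) (b j) ↔ (j = i ∨ j = i + 1 ∨ (i + 1 = n ∧ j = 0))) :
    (SimpleGraph.cycleGraph (2 * n)).IsIndContained G := by
  have hbinj : ∀ i < n, ∀ j < n, b i = b j → i = j := by
    intro i hi j hj h
    have h1 := (hab i hi i hi).2 (Or.inl rfl)
    have h2 := (hab j hj j hj).2 (Or.inl rfl)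
    rw [h, hab i hi j hj] at h1
    rw [← h, hab j hj i hi] at h2
    omega
  have hainj : ∀ i < n, ∀ j < n, a i = a j → i = j := by
    intro i hi j hj h
    have h1 := (hab i hi i hi).2 (Or.inl rfl)
    have h2 := (hab j hj j hj).2 (Or.inl rfl)
    rw [h, hab j hj i hi] at h1
    rw [← h, hab i hi j hj] at h2
    omega
  have hne : ∀ i < n, ∀ j < n, a i ≠ b j := by
    intro i hi j hj h
    have h1 := (hab i hi i hi).2 (Or.inl rfl)
    rw [h] at h1
    exact hb j hj i hi h1
  let φ : Fin (2 * n) → V := fun x => if x.val % 2 = 0 then b (x.val / 2) else a (x.val / 2)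
  have hφ : Function.Injective φ := by
    intro x y hxy
    have hx := x.isLt
    have hy := y.isLt
    simp only [φ] at hxy
    apply Fin.ext
    split_ifs at hxy with h1 h2 h2
    · have := hbinj _ (by omega) _ (by omega) hxy; omega
    · exact absurd hxy.symm (hne _ (by omega) _ (by omega))
    · exact absurd hxy (hne _ (by omega) _ (by omega))
    · have := hainj _ (by omega) _ (by omega) hxy; omega
  refine ⟨⟨⟨φ, hφ⟩, ?_⟩⟩
  intro x y
  have hx := x.isLt
  have hy := y.isLt
  rw [cycleGraph_adj_iff_val]
  simp only [Function.Embedding.coeFn_mk, φ]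
  split_ifs with h1 h2 h2
  · have := hb (x.val / 2) (by omega) (y.val / 2) (by omega)
    simp only [this, false_iff]; omega
  · rw [G.adj_comm, hab _ (by omega) _ (by omega)]; omega
  · rw [hab _ (by omega) _ (by omega)]; omega
  · have := ha (x.val / 2) (by omega) (y.val / 2) (by omega)
    simp only [this, false_iff]; omega

/-- A finite set in which every vertex has more than `t ≥ 1` neighbours contains a cycle with more
than `t + 1` vertices: close up a longest path at its first vertex. -/
theorem exists_cycle_of_min_degree {V : Type*} {R : V → V → Prop} (hsymm : ∀ x y, R x y → R y x)
    (hirr : ∀ x, ¬ R x x) {S : Finset V} (hS : S.Nonempty) {t : ℕ}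
    (hdeg : ∀ x ∈ S, t < (relNbrs R S x).card) :
    ∃ (n : ℕ) (c : ℕ → V), t + 2 ≤ n ∧ (∀ i < n, c i ∈ S) ∧
      (∀ i < n, ∀ j < n, c i = c j → i = j) ∧ (∀ i, i + 1 < n → R (c i) (c (i + 1))) ∧
      R (c (n - 1)) (c 0) := by
  classical
  let IsP : ℕ → (ℕ → V) → Prop := fun m f => (∀ i < m, f i ∈ S) ∧
    (∀ i < m, ∀ j < m, f i = f j → i = j) ∧ (∀ i, i + 1 < m → R (f i) (f (i + 1)))
  have hbound : ∀ m f, IsP m f → m ≤ S.card := by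
    intro m f ⟨h1, h2, _⟩
    have := Finset.card_le_card_of_injOn (s := Finset.range m) (t := S) f
      (fun i hi => h1 i (Finset.mem_range.1 hi))
      (fun i hi j hj h => h2 i (by simpa using hi) j (by simpa using hj) h)
    simpa using this
  obtain ⟨x0, hx0⟩ := hS
  have hex : ∃ m, ∃ f, IsP m f ∧ 1 ≤ m :=
    ⟨1, fun _ => x0, ⟨fun _ _ => hx0, fun i hi j hj _ => by omega, fun i hi => by omega⟩, le_rfl⟩
  have hfin : ∀ m, (∃ f, IsP m f ∧ 1 ≤ m) → m ≤ S.card := fun m ⟨f, hf, _⟩ => hbound m f hf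
  let m := Nat.findGreatest (fun m => ∃ f, IsP m f ∧ 1 ≤ m) S.card
  obtain ⟨m0, hm0⟩ := hex
  obtain ⟨f, ⟨hf1, hf2, hf3⟩, hm1⟩ : ∃ f, IsP m f ∧ 1 ≤ m :=
    Nat.findGreatest_spec (P := fun m => ∃ f, IsP m f ∧ 1 ≤ m) (hfin m0 hm0) hm0
  -- every neighbour of the first vertex lies on the path
  have hon : ∀ y ∈ relNbrs R S (f 0), ∃ i, 1 ≤ i ∧ i < m ∧ f i = y := by
    intro y hy
    obtain ⟨hyS, hRy⟩ := mem_relNbrs.1 hy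
    by_contra hcon
    push Not at hcon
    have hy0 : y ≠ f 0 := fun h => hirr _ (h ▸ hRy)
    have hny : ∀ i < m, f i ≠ y := by
      intro i hi
      rcases Nat.eq_zero_or_pos i with rfl | h
      · exact hy0.symm
      · exact hcon i h hi
    have hP : IsP (m + 1) (fun i => if i = 0 then y else f (i - 1)) := by
      refine ⟨?_, ?_, ?_⟩
      · intro i hi
        dsimp only
        split_ifs
        · exact hyS
        · exact hf1 _ (by omega)
      · intro i hi j hj h
        dsimp only at h
        split_ifs at h
        · omega
        · exact absurd h.symm (hny _ (by omega))
        · exact absurd h (hny _ (by omega))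
        · have := hf2 _ (by omega) _ (by omega) h; omega
      · intro i hi
        dsimp only
        rcases Nat.eq_zero_or_pos i with rfl | h
        · simpa using hsymm _ _ hRy
        · rw [if_neg (by omega), if_neg (by omega)]
          have := hf3 (i - 1) (by omega)
          rwa [show i - 1 + 1 = i + 1 - 1 by omega] at this
    have h1 : m + 1 ≤ m := Nat.le_findGreatest (hbound _ _ hP) ⟨_, hP, by omega⟩
    omega
  -- the neighbours have distinct positions, so one of them is far away
  have hfar : ∃ i, t + 1 ≤ i ∧ i < m ∧ R (f 0) (f i) := by
    by_contra hcon
    push Not at hcon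
    have hsub : relNbrs R S (f 0) ⊆ (Finset.Icc 1 t).image f := by
      intro y hy
      obtain ⟨i, hi1, him, rfl⟩ := hon y hy
      refine Finset.mem_image.2 ⟨i, Finset.mem_Icc.2 ⟨hi1, ?_⟩, rfl⟩
      by_contra hlt
      exact hcon i (by omega) him (mem_relNbrs.1 hy).2
    have h1 := (Finset.card_le_card hsub).trans Finset.card_image_le
    have h2 := hdeg (f 0) (hf1 0 (by omega))
    simp at h1
    omega
  obtain ⟨i, hi, him, hR⟩ := hfar
  refine ⟨i + 1, f, by omega, fun j hj => hf1 j (by omega),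
    fun j hj k hk => hf2 j (by omega) k (by omega), fun j hj => hf3 j (by omega), ?_⟩
  simpa using hsymm _ _ hR

/-- The relation `R` restricted to `B` is `k`-degenerate. -/
def IsDegenerateOn {V : Type*} (R : V → V → Prop) (B : Finset V) (k : ℕ) : Prop :=
  ∀ W ⊆ B, W.Nonempty → ∃ v ∈ W, (relNbrs R W v).card ≤ k

/-- A degenerate relation has an orientation with bounded out-degree; `β v` is the set of
out-neighbours of `v`. -/
theorem IsDegenerateOn.exists_orientation {V : Type*} {R : V → V → Prop}
    (hsymm : ∀ x y, R x y → R y x) {k : ℕ} {B : Finset V} (h : IsDegenerateOn R B k) :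
    ∃ β : V → Finset V, (∀ v, (β v).card ≤ k) ∧ (∀ v, ∀ x ∈ β v, x ∈ B ∧ R v x) ∧
      ∀ x ∈ B, ∀ y ∈ B, R x y → y ∈ β x ∨ x ∈ β y := by
  classical
  induction B using Finset.strongInduction with
  | H B ih =>
    rcases B.eq_empty_or_nonempty with rfl | hne
    · exact ⟨fun _ => ∅, by simp, by simp, by simp⟩
    · obtain ⟨v, hv, hvk⟩ := h B subset_rfl hne
      obtain ⟨β, h1, h2, h3⟩ := ih (B.erase v) (Finset.erase_ssubset hv)
        (fun W hW => h W (hW.trans (Finset.erase_subset _ _)))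
      refine ⟨Function.update β v (relNbrs R B v), ?_, ?_, ?_⟩
      · intro x
        by_cases hx : x = v
        · subst hx; simpa using hvk
        · simpa [hx] using h1 x
      · intro x y hy
        by_cases hx : x = v
        · subst hx
          simp only [Function.update_self] at hy
          exact mem_relNbrs.1 hy
        · simp only [ne_eq, hx, not_false_eq_true, Function.update_of_ne] at hy
          exact ⟨Finset.mem_of_mem_erase (h2 x y hy).1, (h2 x y hy).2⟩
      · intro x hx y hy hxy
        by_cases hxv : x = v
        · subst hxv
          left
          simpa [mem_relNbrs] using ⟨hy, hxy⟩
        · by_cases hyv : y = v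
          · subst hyv
            right
            simpa [mem_relNbrs] using ⟨hx, hsymm _ _ hxy⟩
          · simpa [hxv, hyv] using h3 x (Finset.mem_erase.2 ⟨hxv, hx⟩) y
              (Finset.mem_erase.2 ⟨hyv, hy⟩) hxy

theorem IsDegenerateOn.colorable {V : Type*} [Fintype V] {G : SimpleGraph V} {k : ℕ}
    (h : IsDegenerateOn G.Adj Finset.univ k) : G.Colorable (k + 1) := by
  classical
  suffices H : ∀ B : Finset V, ∃ c : V → Fin (k + 1), ∀ x ∈ B, ∀ y ∈ B, G.Adj x y → c x ≠ c y by
    obtain ⟨c, hc⟩ := H Finset.univ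
    exact ⟨SimpleGraph.Coloring.mk c fun hxy => hc _ (Finset.mem_univ _) _ (Finset.mem_univ _) hxy⟩
  intro B
  induction B using Finset.strongInduction with
  | H B ih =>
    rcases B.eq_empty_or_nonempty with rfl | hne
    · exact ⟨fun _ => 0, by simp⟩
    · obtain ⟨v, hv, hvk⟩ := h B (Finset.subset_univ _) hne
      obtain ⟨c, hc⟩ := ih (B.erase v) (Finset.erase_ssubset hv)
      obtain ⟨i, hi⟩ : ∃ i : Fin (k + 1), i ∉ (relNbrs G.Adj B v).image c := by
        by_contra hcon
        push Not at hcon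
        have h1 : (Finset.univ : Finset (Fin (k + 1))).card ≤ ((relNbrs G.Adj B v).image c).card :=
          Finset.card_le_card fun i _ => hcon i
        have h2 := h1.trans Finset.card_image_le
        simp at h2
        omega
      have hi' : ∀ y ∈ B, G.Adj v y → c y ≠ i := fun y hy hvy hcy =>
        hi (Finset.mem_image.2 ⟨y, mem_relNbrs.2 ⟨hy, hvy⟩, hcy⟩)
      refine ⟨Function.update c v i, ?_⟩
      intro x hx y hy hxy
      by_cases hxv : x = v
      · subst hxv
        have : y ≠ x := hxy.ne'
        simpa [this] using (hi' y hy hxy).symm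
      · by_cases hyv : y = v
        · subst hyv
          simpa [hxv] using hi' x hx hxy.symm
        · simpa [hxv, hyv] using hc x (Finset.mem_erase.2 ⟨hxv, hx⟩) y
            (Finset.mem_erase.2 ⟨hyv, hy⟩) hxy

/-- The number of ordered pairs in `W` that are related by `R`. -/
noncomputable def adjPairs {V : Type*} (R : V → V → Prop) (W : Finset V) : ℕ :=
  ∑ v ∈ W, (relNbrs R W v).card

theorem isDegenerateOn_of_adjPairs_le {V : Type*} {R : V → V → Prop} {B : Finset V} {k : ℕ}
    (h : ∀ W ⊆ B, W.Nonempty → adjPairs R W < (k + 1) * W.card) : IsDegenerateOn R B k := by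
  intro W hW hne
  by_contra hcon
  push Not at hcon
  have h1 := h W hW hne
  have h2 : ∑ _v ∈ W, (k + 1) ≤ adjPairs R W := Finset.sum_le_sum fun v hv => hcon v hv
  rw [Finset.sum_const, smul_eq_mul, mul_comm] at h2
  omega

/-- `G` has no `K_{Λ,Λ}` as a subgraph, in terms of finite vertex sets. -/
def NoBiclique {V : Type*} (G : SimpleGraph V) (Λ : ℕ) : Prop :=
  ∀ S T : Finset V, (∀ x ∈ S, ∀ y ∈ T, G.Adj x y) → S.card < Λ ∨ T.card < Λ

theorem NoBiclique.mono {V : Type*} {G : SimpleGraph V} {Λ Λ' : ℕ} (h : NoBiclique G Λ)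
    (hle : Λ ≤ Λ') : NoBiclique G Λ' := fun S T hST =>
  (h S T hST).imp (fun h => h.trans_le hle) (fun h => h.trans_le hle)

theorem noBiclique_of_free {V : Type*} {G : SimpleGraph V} {ℓ : ℕ}
    (h : (completeBipartiteGraph (Fin ℓ) (Fin ℓ)).Free G) : NoBiclique G ℓ := by
  intro S T hST
  by_contra hcon
  push Not at hcon
  obtain ⟨S', hS', hS'c⟩ := Finset.exists_subset_card_eq hcon.1
  obtain ⟨T', hT', hT'c⟩ := Finset.exists_subset_card_eq hcon.2
  apply h
  rw [SimpleGraph.completeBipartiteGraph_isContained_iff]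
  exact ⟨S', T', by simp [hS'c], by simp [hT'c], fun x hx y hy => hST x (hS' hx) y (hT' hy)⟩

/-! ### Non-neighbours and independent tuples in graphs without large bicliques -/

/-- In a graph without `K_{Λ,Λ}`, fewer than `Λ` vertices are adjacent to almost all of a
large set `S`. -/
theorem NoBiclique.card_lt_of_few_nonNbrs {V : Type*} {G : SimpleGraph V} {Λ : ℕ}
    (h : NoBiclique G Λ) (hΛ : 1 ≤ Λ) {S T : Finset V} (hS : 4 * Λ ≤ S.card)
    (hT : ∀ y ∈ T, (relNbrs Gᶜ.Adj S y).card * (4 * Λ) < S.card) : T.card < Λ := by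
  classical
  by_contra hcon
  push Not at hcon
  obtain ⟨T', hT', hT'c⟩ := Finset.exists_subset_card_eq hcon
  let C := S.filter fun x => ∀ y ∈ T', G.Adj y x
  have hsub : S \ C ⊆ T'.biUnion fun y => insert y (relNbrs Gᶜ.Adj S y) := by
    intro x hx
    obtain ⟨hxS, hxC⟩ := Finset.mem_sdiff.1 hx
    simp only [C, Finset.mem_filter, not_and, not_forall] at hxC
    obtain ⟨y, hy, hxy⟩ := hxC hxS
    refine Finset.mem_biUnion.2 ⟨y, hy, ?_⟩
    by_cases hyx : x = y
    · simp [hyx]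
    · refine Finset.mem_insert_of_mem (mem_relNbrs.2 ⟨hxS, ?_⟩)
      rw [SimpleGraph.compl_adj]
      exact ⟨Ne.symm hyx, hxy⟩
  have h1 : (S \ C).card * (4 * Λ) ≤ Λ * (2 * S.card) := by
    calc (S \ C).card * (4 * Λ)
        ≤ (∑ y ∈ T', ((relNbrs Gᶜ.Adj S y).card + 1)) * (4 * Λ) := by
          refine Nat.mul_le_mul_right _ ((Finset.card_le_card hsub).trans ?_)
          exact Finset.card_biUnion_le.trans
            (Finset.sum_le_sum fun y _ => Finset.card_insert_le _ _)
      _ = ∑ y ∈ T', ((relNbrs Gᶜ.Adj S y).card + 1) * (4 * Λ) := Finset.sum_mul _ _ _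
      _ ≤ ∑ _y ∈ T', 2 * S.card := by
          refine Finset.sum_le_sum fun y hy => ?_
          have := hT y (hT' hy)
          rw [add_mul]; omega
      _ = Λ * (2 * S.card) := by rw [Finset.sum_const, hT'c, smul_eq_mul]
  have h2 : (S \ C).card * 2 ≤ S.card := by
    refine Nat.le_of_mul_le_mul_left (c := 2 * Λ) ?_ (by omega)
    calc 2 * Λ * ((S \ C).card * 2) = (S \ C).card * (4 * Λ) := by ring
      _ ≤ _ := h1
      _ = _ := by ring
  have h3 : (S \ C).card + C.card = S.card :=
    Finset.card_sdiff_add_card_eq_card (Finset.filter_subset _ _)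
  have h4 := h T' C fun y hy x hx => (Finset.mem_filter.1 hx).2 y hy
  omega

/-- Large sets indexed by `Fin s` have a system of pairwise nonadjacent representatives. -/
theorem NoBiclique.exists_transversal {V : Type*} {G : SimpleGraph V} {Λ : ℕ}
    (h : NoBiclique G Λ) (hΛ : 1 ≤ Λ) (s : ℕ) (A : Fin s → Finset V)
    (hA : ∀ i, (4 * Λ) ^ (s + 1) ≤ (A i).card) :
    ∃ a : Fin s → V, (∀ i, a i ∈ A i) ∧ ∀ i j, i ≠ j → Gᶜ.Adj (a i) (a j) := by
  classical
  induction s with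
  | zero => exact ⟨Fin.elim0, fun i => i.elim0, fun i => i.elim0⟩
  | succ s ih =>
    have hpos : 0 < 4 * Λ := by omega
    -- a representative of the first set with many non-neighbours in all the others
    obtain ⟨x, hx, hgood⟩ : ∃ x ∈ A 0, ∀ i : Fin s,
        (A i.succ).card ≤ (relNbrs Gᶜ.Adj (A i.succ) x).card * (4 * Λ) := by
      by_contra hcon
      push Not at hcon
      have hsub : A 0 ⊆ Finset.univ.biUnion fun i : Fin s => (A 0).filter fun x =>
          (relNbrs Gᶜ.Adj (A i.succ) x).card * (4 * Λ) < (A i.succ).card := by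
        intro x hx
        obtain ⟨i, hi⟩ := hcon x hx
        exact Finset.mem_biUnion.2 ⟨i, Finset.mem_univ _, Finset.mem_filter.2 ⟨hx, hi⟩⟩
      have h1 : (A 0).card ≤ s * Λ := by
        refine (Finset.card_le_card hsub).trans (Finset.card_biUnion_le.trans ?_)
        refine (Finset.sum_le_card_nsmul _ _ Λ fun i _ => ?_).trans (by simp)
        refine (h.card_lt_of_few_nonNbrs hΛ ?_ fun y hy => (Finset.mem_filter.1 hy).2).le
        exact (Nat.le_self_pow (by omega) _).trans (hA i.succ)
      have h2 : s < 4 ^ s := Nat.lt_pow_self (by norm_num)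
      have h3 : 4 ^ s ≤ (4 * Λ) ^ s := Nat.pow_le_pow_left (by omega) s
      have h4 := hA 0
      have h5 : (4 * Λ) ^ s * (4 * Λ) ≤ (4 * Λ) ^ (s + 1 + 1) := by
        rw [← pow_succ]
        exact Nat.pow_le_pow_right hpos (by omega)
      have h6 : s * Λ < (4 * Λ) ^ s * (4 * Λ) :=
        Nat.mul_lt_mul_of_lt_of_le (by omega) (by omega) (by omega)
      omega
    obtain ⟨a, ha, ha'⟩ := ih (fun i => relNbrs Gᶜ.Adj (A i.succ) x) fun i => by
      have h1 := (hA i.succ).trans (hgood i)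
      rw [pow_succ] at h1
      exact Nat.le_of_mul_le_mul_right h1 hpos
    refine ⟨Fin.cons x a, ?_, ?_⟩
    · intro i
      refine Fin.cases ?_ (fun i => ?_) i
      · simpa using hx
      · simpa using (mem_relNbrs.1 (ha i)).1
    · intro i j
      refine Fin.cases ?_ (fun i => ?_) i <;> refine Fin.cases ?_ (fun j => ?_) j
      · simp
      · intro _
        simpa using (mem_relNbrs.1 (ha j)).2
      · intro _
        simpa using (mem_relNbrs.1 (ha i)).2.symm
      · intro hij
        simpa using ha' i j (fun h => hij (h ▸ rfl))

open scoped Classical in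
/-- The tuples of `s` distinct pairwise nonadjacent vertices of `B`. -/
noncomputable def indepTuples {V : Type*} (G : SimpleGraph V) (s : ℕ) (B : Finset V) :
    Finset (Fin s → V) :=
  (Fintype.piFinset fun _ => B).filter fun f => ∀ i j, i ≠ j → Gᶜ.Adj (f i) (f j)

/-- A polynomial fraction of all tuples is independent. -/
theorem NoBiclique.card_pow_le_indepTuples {V : Type*} {G : SimpleGraph V} {Λ : ℕ}
    (h : NoBiclique G Λ) (hΛ : 1 ≤ Λ) (s : ℕ) (B : Finset V) (hB : (4 * Λ) ^ (s + 1) ≤ B.card) :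
    B.card ^ s ≤ (indepTuples G s B).card * (8 * Λ) ^ (s ^ 2) := by
  classical
  induction s generalizing B with
  | zero =>
    have : (indepTuples G 0 B).Nonempty :=
      ⟨Fin.elim0, Finset.mem_filter.2
        ⟨Fintype.mem_piFinset.2 fun i => i.elim0, fun i => i.elim0⟩⟩
    have := this.card_pos
    simp only [pow_zero, ne_eq, OfNat.ofNat_ne_zero, not_false_eq_true, zero_pow, mul_one]
    omega
  | succ s ih =>
    have hpos : 0 < 4 * Λ := by omega
    have h4B : 4 * Λ ≤ B.card := (Nat.le_self_pow (by omega) _).trans hB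
    let B' := B.filter fun b => B.card ≤ (relNbrs Gᶜ.Adj B b).card * (4 * Λ)
    have hB' : B.card ≤ 2 * B'.card := by
      have h1 := Finset.card_filter_add_card_filter_not (s := B)
        (fun b => B.card ≤ (relNbrs Gᶜ.Adj B b).card * (4 * Λ))
      have h2 := h.card_lt_of_few_nonNbrs hΛ h4B
        (T := B.filter fun b => ¬ B.card ≤ (relNbrs Gᶜ.Adj B b).card * (4 * Λ))
        (fun y hy => not_le.1 (Finset.mem_filter.1 hy).2)
      change B'.card + _ = _ at h1
      omega
    have hstep : ∀ b ∈ B', B.card ^ s ≤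
        (indepTuples G s (relNbrs Gᶜ.Adj B b)).card * ((8 * Λ) ^ (s ^ 2) * (4 * Λ) ^ s) := by
      intro b hb
      have hb2 := (Finset.mem_filter.1 hb).2
      have h1 := ih (relNbrs Gᶜ.Adj B b) (by
        have h1 := hB.trans hb2
        rw [pow_succ] at h1
        exact Nat.le_of_mul_le_mul_right h1 hpos)
      calc B.card ^ s ≤ ((relNbrs Gᶜ.Adj B b).card * (4 * Λ)) ^ s := Nat.pow_le_pow_left hb2 s
        _ = (relNbrs Gᶜ.Adj B b).card ^ s * (4 * Λ) ^ s := mul_pow _ _ _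
        _ ≤ _ * (4 * Λ) ^ s := Nat.mul_le_mul_right _ h1
        _ = _ := by ring
    have hinj : ∑ b ∈ B', (indepTuples G s (relNbrs Gᶜ.Adj B b)).card ≤
        (indepTuples G (s + 1) B).card := by
      rw [← Finset.card_sigma]
      refine Finset.card_le_card_of_injOn
        (fun p : (_ : V) × (Fin s → V) => (Fin.cons p.1 p.2 : Fin (s + 1) → V)) ?_ ?_
      · rintro ⟨b, f⟩ hp
        simp only [Finset.coe_sigma, Set.mem_sigma_iff, Finset.mem_coe] at hp
        obtain ⟨hb, hf⟩ := hp
        obtain ⟨hf1, hf2⟩ := Finset.mem_filter.1 hf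
        rw [Fintype.mem_piFinset] at hf1
        refine Finset.mem_filter.2 ⟨Fintype.mem_piFinset.2 ?_, ?_⟩
        · intro i
          refine Fin.cases ?_ (fun i => ?_) i
          · simpa using (Finset.mem_filter.1 hb).1
          · simpa using (mem_relNbrs.1 (hf1 i)).1
        · intro i j
          refine Fin.cases ?_ (fun i => ?_) i <;> refine Fin.cases ?_ (fun j => ?_) j
          · simp
          · intro _
            simpa using (mem_relNbrs.1 (hf1 j)).2
          · intro _
            simpa using (mem_relNbrs.1 (hf1 i)).2.symm
          · intro hij
            simpa using hf2 i j (fun h => hij (h ▸ rfl))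
      · rintro ⟨b, f⟩ _ ⟨b', f'⟩ _ heq
        simp only [Fin.cons_inj] at heq
        obtain ⟨rfl, rfl⟩ := heq
        rfl
    calc B.card ^ (s + 1) = B.card * B.card ^ s := by ring
      _ ≤ 2 * (B'.card * B.card ^ s) := by
        rw [← mul_assoc]; exact Nat.mul_le_mul_right _ hB'
      _ = 2 * ∑ _b ∈ B', B.card ^ s := by rw [Finset.sum_const, smul_eq_mul]
      _ ≤ 2 * ∑ b ∈ B', (indepTuples G s (relNbrs Gᶜ.Adj B b)).card *
          ((8 * Λ) ^ (s ^ 2) * (4 * Λ) ^ s) :=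
        Nat.mul_le_mul_left _ (Finset.sum_le_sum hstep)
      _ = (∑ b ∈ B', (indepTuples G s (relNbrs Gᶜ.Adj B b)).card) *
          ((8 * Λ) ^ (s ^ 2) * (2 * (4 * Λ) ^ s)) := by rw [← Finset.sum_mul]; ring
      _ ≤ (indepTuples G (s + 1) B).card * ((8 * Λ) ^ (s ^ 2) * (8 * Λ) ^ (2 * s + 1)) := by
        refine Nat.mul_le_mul hinj (Nat.mul_le_mul_left _ ?_)
        calc 2 * (4 * Λ) ^ s ≤ (8 * Λ) * (8 * Λ) ^ s :=
              Nat.mul_le_mul (by omega) (Nat.pow_le_pow_left (by omega) s)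
          _ = (8 * Λ) ^ (s + 1) := by ring
          _ ≤ _ := Nat.pow_le_pow_right (by omega) (by omega)
      _ = _ := by rw [← pow_add]; congr 2; ring

/-- If, whatever the other coordinates are, at most `M` values of the `j`-th coordinate satisfy a
condition, then at most a fraction `M / |B|` of all tuples satisfies it. -/
theorem card_tuples_mul_le {V : Type*} {s : ℕ} (B : Finset V) (j : Fin s) (M : ℕ)
    (P : (Fin s → V) → V → Prop) [∀ f, DecidablePred (P f)]
    [DecidablePred fun f : Fin s → V => P f (f j)] (hP : ∀ f z y, P (Function.update f j z) y ↔ P f y)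
    (hM : ∀ f, (B.filter (P f)).card ≤ M) :
    ((Fintype.piFinset fun _ : Fin s => B).filter fun f => P f (f j)).card * B.card ≤
      M * B.card ^ s := by
  classical
  have hcard : (Fintype.piFinset fun _ : Fin s => B).card = B.card ^ s := by
    simp [Fintype.card_piFinset]
  have h1 : ((Fintype.piFinset fun _ : Fin s => B).filter fun f => P f (f j)).card * B.card ≤
      ((Fintype.piFinset fun _ : Fin s => B).sigma fun f => B.filter (P f)).card := by
    rw [← Finset.card_product]
    refine Finset.card_le_card_of_injOn
      (fun p => (⟨Function.update p.1 j p.2, p.1 j⟩ : (_ : Fin s → V) × V)) ?_ ?_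
    · rintro ⟨f, z⟩ hp
      simp only [Finset.coe_product, Finset.coe_filter, Fintype.mem_piFinset, Set.mem_prod,
        Set.mem_ofPred_eq, Finset.mem_coe] at hp
      obtain ⟨⟨hf, hPf⟩, hz⟩ := hp
      simp only [Finset.coe_sigma, Set.mem_sigma_iff, Finset.mem_coe, Fintype.mem_piFinset,
        Finset.coe_filter, Set.mem_ofPred_eq, hP]
      refine ⟨fun i => ?_, hf j, hPf⟩
      by_cases hij : i = j
      · subst hij; simpa using hz
      · simpa [hij] using hf i
    · rintro ⟨f, z⟩ _ ⟨f', z'⟩ _ heq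
      simp only [Sigma.mk.injEq, heq_eq_eq] at heq
      obtain ⟨h1, h2⟩ := heq
      have hz : z = z' := by simpa using congrFun h1 j
      have hf : f = f' := by
        funext i
        by_cases hij : i = j
        · subst hij; exact h2
        · simpa [hij] using congrFun h1 i
      rw [hz, hf]
  refine h1.trans ?_
  rw [Finset.card_sigma, ← hcard, mul_comm]
  exact (Finset.sum_le_card_nsmul _ _ M fun f _ => hM f).trans (by simp)

/-! ### Dense sets contain long induced cycles -/

/-- The common neighbours of `b` and `b'` in `W`. -/
noncomputable def commonNbrs {V : Type*} (G : SimpleGraph V) (W : Finset V) (b b' : V) :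
    Finset V :=
  relNbrs (fun _ x => G.Adj b x ∧ G.Adj b' x) W b

theorem mem_commonNbrs {V : Type*} {G : SimpleGraph V} {W : Finset V} {b b' x : V} :
    x ∈ commonNbrs G W b b' ↔ x ∈ W ∧ G.Adj b x ∧ G.Adj b' x := by
  simp [commonNbrs, mem_relNbrs]

/-- Dependent random choice, in the simplest form: a set `W` with at least `|W|² / Λ` adjacent
ordered pairs has a subset `B` with at least `|W| / (4 Λ)` elements in which every vertex has a
large common neighbourhood with all but a fraction `4 / K` of the others. The set `B` is obtained
from the neighbourhood of a suitable vertex. -/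
theorem exists_subset_large_commonNbrs {V : Type*} {G : SimpleGraph V} {Λ K : ℕ}
    {W : Finset V} (hW : W.card ^ 2 ≤ adjPairs G.Adj W * Λ) (hne : W.Nonempty) :
    ∃ B ⊆ W, W.card ≤ 4 * Λ * B.card ∧ ∀ b ∈ B,
      (relNbrs (fun b b' => (commonNbrs G W b b').card * (2 * K * Λ ^ 2) < W.card) B b).card * K ≤
        4 * B.card := by
  classical
  set m := W.card with hm
  have hmpos : 0 < m := hne.card_pos
  let Low : V → V → Prop := fun b b' => (commonNbrs G W b b').card * (2 * K * Λ ^ 2) < m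
  have hcs : m ^ 3 ≤ Λ ^ 2 * ∑ a ∈ W, (relNbrs G.Adj W a).card ^ 2 := by
    have h1 : (adjPairs G.Adj W) ^ 2 ≤ m * ∑ a ∈ W, (relNbrs G.Adj W a).card ^ 2 := by
      have := sq_sum_le_card_mul_sum_sq (s := W) (f := fun a => ((relNbrs G.Adj W a).card : ℤ))
      unfold adjPairs
      exact_mod_cast this
    refine Nat.le_of_mul_le_mul_left (c := m) ?_ hmpos
    calc m * m ^ 3 = (m ^ 2) ^ 2 := by ring
      _ ≤ (adjPairs G.Adj W * Λ) ^ 2 := Nat.pow_le_pow_left hW 2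
      _ = (adjPairs G.Adj W) ^ 2 * Λ ^ 2 := by ring
      _ ≤ _ := Nat.mul_le_mul_right _ h1
      _ = _ := by ring
  have hlow : ∑ a ∈ W, adjPairs Low (relNbrs G.Adj W a) * (2 * K * Λ ^ 2) ≤ m ^ 3 := by
    have h1 : ∑ a ∈ W, adjPairs Low (relNbrs G.Adj W a) =
        ∑ b ∈ W, ∑ b' ∈ W, if Low b b' then (commonNbrs G W b b').card else 0 := by
      have h2 : ∀ a ∈ W, adjPairs Low (relNbrs G.Adj W a) =
          ∑ b ∈ W, ∑ b' ∈ W, if G.Adj a b ∧ G.Adj a b' ∧ Low b b' then 1 else 0 := by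
        intro a _
        unfold adjPairs
        rw [relNbrs, Finset.sum_filter]
        refine Finset.sum_congr rfl fun b _ => ?_
        split_ifs with hab
        · rw [relNbrs, Finset.filter_filter, Finset.card_filter]
          exact Finset.sum_congr rfl fun b' _ => by simp [hab]
        · simp [hab]
      rw [Finset.sum_congr rfl h2, Finset.sum_comm]
      refine Finset.sum_congr rfl fun b _ => ?_
      rw [Finset.sum_comm]
      refine Finset.sum_congr rfl fun b' _ => ?_
      split_ifs with hbb
      · have h3 : (commonNbrs G W b b').card =
            ∑ a ∈ W, if G.Adj b a ∧ G.Adj b' a then 1 else 0 := by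
          unfold commonNbrs relNbrs
          rw [Finset.card_filter]
          exact Finset.sum_congr rfl fun a _ => by congr
        refine Eq.trans (Finset.sum_congr rfl fun a _ => ?_) h3.symm
        simp [hbb, G.adj_comm a]
      · simp [hbb]
    rw [← Finset.sum_mul, h1, Finset.sum_mul]
    calc ∑ b ∈ W, (∑ b' ∈ W, if Low b b' then (commonNbrs G W b b').card else 0) * (2 * K * Λ ^ 2)
        ≤ ∑ _b ∈ W, m * m := by
          refine Finset.sum_le_sum fun b _ => ?_
          rw [Finset.sum_mul]
          refine (Finset.sum_le_card_nsmul _ _ m fun b' _ => ?_).trans (by simp [hm])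
          split_ifs with hbb
          · exact le_of_lt hbb
          · simp
      _ = m ^ 3 := by rw [Finset.sum_const, smul_eq_mul, ← hm]; ring
  obtain ⟨a, _, ha⟩ : ∃ a ∈ W, m ^ 2 + adjPairs Low (relNbrs G.Adj W a) * (2 * K * Λ ^ 2) ≤
      2 * Λ ^ 2 * (relNbrs G.Adj W a).card ^ 2 := by
    refine Finset.exists_le_of_sum_le hne ?_
    rw [Finset.sum_add_distrib, Finset.sum_const, smul_eq_mul, ← hm, ← Finset.mul_sum]
    calc m * m ^ 2 + _ ≤ m ^ 3 + m ^ 3 := by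
          refine add_le_add (le_of_eq (by ring)) hlow
      _ ≤ _ := by rw [mul_assoc, ← two_mul]; exact Nat.mul_le_mul_left _ hcs
  set B₀ := relNbrs G.Adj W a with hB₀
  have hB₀m : m ≤ 2 * Λ * B₀.card := by
    have : m ^ 2 ≤ (2 * Λ * B₀.card) ^ 2 := by
      have h : 2 * Λ ^ 2 * B₀.card ^ 2 ≤ (2 * Λ * B₀.card) ^ 2 := by
        rw [mul_pow, mul_pow]
        exact Nat.mul_le_mul_right _ (Nat.mul_le_mul_right _ (by norm_num))
      omega
    exact (Nat.pow_le_pow_iff_left (by norm_num)).1 this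
  have hΛ : 0 < Λ := by
    rcases Nat.eq_zero_or_pos Λ with h | h
    · subst h; simp at hB₀m; omega
    · exact h
  have hlowK : adjPairs Low B₀ * K ≤ B₀.card ^ 2 := by
    refine Nat.le_of_mul_le_mul_left (c := 2 * Λ ^ 2) ?_ (by positivity)
    calc 2 * Λ ^ 2 * (adjPairs Low B₀ * K) = adjPairs Low B₀ * (2 * K * Λ ^ 2) := by ring
      _ ≤ _ := by omega
  let B := B₀.filter fun b => (relNbrs Low B₀ b).card * K ≤ 2 * B₀.card
  have hBc : B₀.card ≤ 2 * B.card := by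
    have h1 := Finset.card_filter_add_card_filter_not (s := B₀)
        (fun b => (relNbrs Low B₀ b).card * K ≤ 2 * B₀.card)
    change B.card + _ = _ at h1
    set X := B₀.filter fun b => ¬ (relNbrs Low B₀ b).card * K ≤ 2 * B₀.card with hX
    have h2 : X.card * (2 * B₀.card) ≤ B₀.card ^ 2 := by
      refine le_trans ?_ hlowK
      calc X.card * (2 * B₀.card) = ∑ _b ∈ X, 2 * B₀.card := by simp
        _ ≤ ∑ b ∈ X, (relNbrs Low B₀ b).card * K :=
          Finset.sum_le_sum fun b hb => (not_le.1 (Finset.mem_filter.1 hb).2).le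
        _ = (∑ b ∈ X, (relNbrs Low B₀ b).card) * K := (Finset.sum_mul _ _ _).symm
        _ ≤ _ := Nat.mul_le_mul_right _
          (Finset.sum_le_sum_of_subset (Finset.filter_subset _ _))
    have hpos : 0 < B₀.card := by
      by_contra h0
      have h0' : B₀.card = 0 := by omega
      rw [h0'] at hB₀m
      omega
    have h3 : 2 * X.card ≤ B₀.card := by
      refine Nat.le_of_mul_le_mul_left (c := B₀.card) ?_ hpos
      calc B₀.card * (2 * X.card) = X.card * (2 * B₀.card) := by ring
        _ ≤ _ := h2
        _ = _ := by ring
    omega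
  refine ⟨B, (Finset.filter_subset _ _).trans (relNbrs_subset _ _ _), ?_, ?_⟩
  · calc m ≤ 2 * Λ * B₀.card := hB₀m
      _ ≤ 2 * Λ * (2 * B.card) := Nat.mul_le_mul_left _ hBc
      _ = _ := by ring
  · intro b hb
    calc (relNbrs Low B b).card * K ≤ (relNbrs Low B₀ b).card * K :=
          Nat.mul_le_mul_right _ (Finset.card_le_card (relNbrs_mono _ (Finset.filter_subset _ _) _))
      _ ≤ 2 * B₀.card := (Finset.mem_filter.1 hb).2
      _ ≤ 4 * B.card := by omega

theorem Fin.val_add_one_eq {t : ℕ} (i : Fin (t + 3)) :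
    (i + 1).val = if i.val + 1 = t + 3 then 0 else i.val + 1 := by
  rw [Fin.val_add_one]
  have : i = Fin.last (t + 2) ↔ i.val + 1 = t + 3 := by
    rw [Fin.ext_iff, Fin.val_last]; omega
  simp only [this]

/-- A large set which spans at least a fraction `1 / Λ` of all pairs in a graph without
`K_{Λ,Λ}` contains all the ingredients of an induced cycle of length `2 (t + 3)`. -/
theorem NoBiclique.isIndContained_of_dense {V : Type*} {G : SimpleGraph V} {Λ t : ℕ}
    (h : NoBiclique G Λ) (hΛ : 1 ≤ Λ) {W : Finset V}
    (hbig : (8 * Λ) ^ ((t + 3) ^ 2 + 3 * (t + 3) + 10) ≤ W.card)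
    (hW : W.card ^ 2 ≤ adjPairs G.Adj W * Λ) :
    (SimpleGraph.cycleGraph (2 * (t + 3))).IsIndContained G := by
  classical
  set s := t + 3 with hs
  set Q := (8 * Λ) ^ (s ^ 2) with hQ
  set K := 16 * s * Q with hKdef
  have hΛ8 : 1 ≤ 8 * Λ := by omega
  have hQ1 : 1 ≤ Q := Nat.one_le_pow _ _ hΛ8
  have hK1 : 1 ≤ K := by
    rw [hKdef]; exact Nat.mul_pos (by omega) hQ1
  have hs8 : s ≤ (8 * Λ) ^ s :=
    (Nat.lt_pow_self (by norm_num : 1 < 8)).le.trans (Nat.pow_le_pow_left (by omega) s)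
  have hWne : W.Nonempty := by
    rw [← Finset.card_pos]
    exact lt_of_lt_of_le (Nat.pow_pos (by omega)) hbig
  -- the numerical consequences of `hbig`
  have hnum1 : 2 * K * Λ ^ 2 * (4 * Λ) ^ (2 * s + 1) ≤ W.card := by
    refine le_trans ?_ hbig
    calc 2 * K * Λ ^ 2 * (4 * Λ) ^ (2 * s + 1)
        = 32 * s * Q * Λ ^ 2 * (4 * Λ) ^ (2 * s + 1) := by rw [hKdef]; ring
      _ ≤ (8 * Λ) ^ 2 * (8 * Λ) ^ s * Q * (8 * Λ) ^ 2 * (8 * Λ) ^ (2 * s + 1) := by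
          have h32 : 32 ≤ (8 * Λ) ^ 2 := by
            calc 32 ≤ 8 ^ 2 := by norm_num
              _ ≤ _ := Nat.pow_le_pow_left (by omega) 2
          gcongr <;> omega
      _ = (8 * Λ) ^ (s ^ 2 + 3 * s + 5) := by rw [hQ]; ring
      _ ≤ _ := Nat.pow_le_pow_right hΛ8 (by omega)
  have hnum2 : 16 * s ^ 2 * Λ * Q * Λ ≤ W.card := by
    refine le_trans ?_ hbig
    calc 16 * s ^ 2 * Λ * Q * Λ
      _ ≤ (8 * Λ) ^ 2 * ((8 * Λ) ^ s) ^ 2 * (8 * Λ) * Q * (8 * Λ) := by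
          have h32 : 16 ≤ (8 * Λ) ^ 2 := by
            calc 16 ≤ 8 ^ 2 := by norm_num
              _ ≤ _ := Nat.pow_le_pow_left (by omega) 2
          gcongr <;> omega
      _ = (8 * Λ) ^ (s ^ 2 + 2 * s + 4) := by rw [hQ]; ring
      _ ≤ _ := Nat.pow_le_pow_right hΛ8 (by omega)
  have hnum3 : (4 * Λ) ^ (s + 1) * (4 * Λ) ≤ W.card := by
    refine le_trans ?_ hbig
    rw [← pow_succ]
    exact (Nat.pow_le_pow_left (by omega) _).trans (Nat.pow_le_pow_right hΛ8 (by nlinarith))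
  obtain ⟨B, hBW, hBc, hBlow⟩ := exists_subset_large_commonNbrs (G := G) (K := K) hW hWne
  set Low : V → V → Prop := fun b b' => (commonNbrs G W b b').card * (2 * K * Λ ^ 2) < W.card
    with hLow
  have hB1 : (4 * Λ) ^ (s + 1) ≤ B.card := by
    refine Nat.le_of_mul_le_mul_right (c := 4 * Λ) ?_ (by omega)
    rw [mul_comm B.card]
    exact hnum3.trans hBc
  have hB2 : 4 * s ^ 2 * Λ * Q ≤ B.card := by
    refine Nat.le_of_mul_le_mul_right (c := 4 * Λ) ?_ (by omega)
    rw [mul_comm B.card]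
    refine le_trans (le_of_eq ?_) (hnum2.trans hBc)
    ring
  have hBpos : 0 < B.card := lt_of_lt_of_le (Nat.pow_pos (by omega)) hB1
  -- the candidates for the common neighbour of `f i` and `f (i + 1)` that see none of the other
  -- `f j'` with `j' < j`
  let T : (Fin s → V) → Fin s → ℕ → Finset V := fun f i j =>
    (commonNbrs G W (f i) (f (i + 1))).filter fun x =>
      ∀ j' : Fin s, j'.val < j → j' ≠ i → j' ≠ i + 1 → Gᶜ.Adj (f j') x
  have hsucc : ∀ i : Fin s, i ≠ i + 1 := by
    intro i hi
    have h1 := Fin.val_add_one_eq i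
    rw [← hi] at h1
    split_ifs at h1 <;> omega
  let E₁ : Fin s → Finset (Fin s → V) := fun i =>
    (Fintype.piFinset fun _ => B).filter fun f => f i ∈ B ∧ Low (f i) (f (i + 1))
  let P₂ : Fin s → Fin s → (Fin s → V) → V → Prop := fun i j f y =>
    j ≠ i ∧ j ≠ i + 1 ∧ 4 * Λ ≤ (T f i j).card ∧
      (relNbrs Gᶜ.Adj (T f i j) y).card * (4 * Λ) < (T f i j).card
  let E₂ : Fin s → Fin s → Finset (Fin s → V) := fun i j =>
    (Fintype.piFinset fun _ => B).filter fun f => P₂ i j f (f j)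
  have hE₁ : ∀ i, (E₁ i).card * K ≤ 4 * B.card ^ s := by
    intro i
    have h1 := card_tuples_mul_le B (i + 1) (4 * B.card / K) (fun f y => f i ∈ B ∧ Low (f i) y)
      (fun f z y => by simp only [Function.update_of_ne (hsucc i)])
      (fun f => by
        by_cases hfi : f i ∈ B
        · rw [Nat.le_div_iff_mul_le hK1]
          refine le_trans (Nat.mul_le_mul_right _ (Finset.card_le_card ?_)) (hBlow (f i) hfi)
          intro y hy
          obtain ⟨hyB, _, hy⟩ := Finset.mem_filter.1 hy
          exact mem_relNbrs.2 ⟨hyB, hy⟩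
        · simp [hfi])
    refine Nat.le_of_mul_le_mul_right (c := B.card) ?_ hBpos
    calc (E₁ i).card * K * B.card = (E₁ i).card * B.card * K := by ring
      _ ≤ 4 * B.card / K * B.card ^ s * K := Nat.mul_le_mul_right _ h1
      _ = 4 * B.card / K * K * B.card ^ s := by ring
      _ ≤ 4 * B.card * B.card ^ s := Nat.mul_le_mul_right _ (Nat.div_mul_le_self _ _)
      _ = _ := by ring
  have hE₂ : ∀ i j, (E₂ i j).card * B.card ≤ Λ * B.card ^ s := by
    intro i j
    refine card_tuples_mul_le B j Λ (P₂ i j) ?_ ?_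
    · intro f z y
      by_cases hj : j ≠ i ∧ j ≠ i + 1
      · have hT : T (Function.update f j z) i j = T f i j := by
          simp only [T]
          rw [Function.update_of_ne hj.1.symm, Function.update_of_ne hj.2.symm]
          refine Finset.filter_congr fun x _ => forall_congr' fun j' => ?_
          refine imp_congr_right fun hlt => ?_
          rw [Function.update_of_ne (Fin.ne_of_lt hlt)]
        simp only [P₂, hT]
      · simp only [P₂]; tauto
    · intro f
      by_cases hT : 4 * Λ ≤ (T f i j).card
      · refine (h.card_lt_of_few_nonNbrs hΛ hT fun y hy => ?_).le
        exact (Finset.mem_filter.1 hy).2.2.2.2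
      · simp [P₂, hT]
  -- counting yields an independent tuple that avoids all bad events
  obtain ⟨f, hfI, hf1, hf2⟩ : ∃ f ∈ indepTuples G s B, (∀ i, f ∉ E₁ i) ∧ ∀ i j, f ∉ E₂ i j := by
    by_contra hcon
    push Not at hcon
    have hsub : indepTuples G s B ⊆ (Finset.univ.biUnion E₁) ∪
        (Finset.univ.biUnion fun i => Finset.univ.biUnion (E₂ i)) := by
      intro f hf
      by_cases hf1 : ∀ i, f ∉ E₁ i
      · obtain ⟨i, j, hij⟩ := hcon f hf hf1
        exact Finset.mem_union_right _ (Finset.mem_biUnion.2 ⟨i, Finset.mem_univ _,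
          Finset.mem_biUnion.2 ⟨j, Finset.mem_univ _, hij⟩⟩)
      · push Not at hf1
        obtain ⟨i, hi⟩ := hf1
        exact Finset.mem_union_left _ (Finset.mem_biUnion.2 ⟨i, Finset.mem_univ _, hi⟩)
    have hc1 : (Finset.univ.biUnion E₁).card * K ≤ s * (4 * B.card ^ s) := by
      refine (Nat.mul_le_mul_right _ Finset.card_biUnion_le).trans ?_
      rw [Finset.sum_mul]
      exact (Finset.sum_le_card_nsmul _ _ _ fun i _ => hE₁ i).trans (by simp)
    have hc2 : (Finset.univ.biUnion fun i => Finset.univ.biUnion (E₂ i)).card * B.card ≤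
        s * (s * (Λ * B.card ^ s)) := by
      refine (Nat.mul_le_mul_right _ Finset.card_biUnion_le).trans ?_
      rw [Finset.sum_mul]
      refine (Finset.sum_le_card_nsmul _ _ (s * (Λ * B.card ^ s)) fun i _ => ?_).trans (by simp)
      refine (Nat.mul_le_mul_right _ Finset.card_biUnion_le).trans ?_
      rw [Finset.sum_mul]
      exact (Finset.sum_le_card_nsmul _ _ _ fun j _ => hE₂ i j).trans (by simp)
    have hI := h.card_pow_le_indepTuples hΛ s B hB1
    have hIc := (Finset.card_le_card hsub).trans (Finset.card_union_le _ _)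
    set N := B.card ^ s
    set x := (Finset.univ.biUnion E₁).card
    set y := (Finset.univ.biUnion fun i => Finset.univ.biUnion (E₂ i)).card
    have hNpos : 0 < N := Nat.pow_pos hBpos
    have hx : 4 * (x * Q) ≤ N := by
      refine Nat.le_of_mul_le_mul_left (c := 4 * s) ?_ (by omega)
      calc 4 * s * (4 * (x * Q)) = x * K := by rw [hKdef]; ring
        _ ≤ _ := hc1
        _ = _ := by ring
    have hy : 4 * (y * Q) ≤ N := by
      refine Nat.le_of_mul_le_mul_left (c := B.card) ?_ hBpos
      calc B.card * (4 * (y * Q)) = y * B.card * (4 * Q) := by ring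
        _ ≤ s * (s * (Λ * N)) * (4 * Q) := Nat.mul_le_mul_right _ hc2
        _ = 4 * s ^ 2 * Λ * Q * N := by ring
        _ ≤ _ := Nat.mul_le_mul_right _ hB2
    have hlast : N ≤ (x + y) * Q := hI.trans (Nat.mul_le_mul_right _ hIc)
    rw [add_mul] at hlast
    omega
  obtain ⟨hfB, hfind⟩ := Finset.mem_filter.1 hfI
  rw [Fintype.mem_piFinset] at hfB
  have hTbig : ∀ i, ∀ j ≤ s, (4 * Λ) ^ (2 * s + 1) ≤ (T f i j).card * (4 * Λ) ^ j := by
    intro i j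
    induction j with
    | zero =>
      intro _
      have h1 : ¬ Low (f i) (f (i + 1)) := fun hl => hf1 i (Finset.mem_filter.2
        ⟨Fintype.mem_piFinset.2 hfB, hfB i, hl⟩)
      have h2 : T f i 0 = commonNbrs G W (f i) (f (i + 1)) := by simp [T]
      rw [h2, pow_zero, mul_one]
      simp only [hLow, not_lt] at h1
      refine Nat.le_of_mul_le_mul_left (c := 2 * K * Λ ^ 2) ?_ (by positivity)
      rw [mul_comm _ (commonNbrs G W (f i) (f (i + 1))).card]
      exact hnum1.trans h1
    | succ j ih =>
      intro hj
      have ih := ih (by omega)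
      set jj : Fin s := ⟨j, by omega⟩ with hjj
      by_cases hji : jj ≠ i ∧ jj ≠ i + 1
      · have h1 : relNbrs Gᶜ.Adj (T f i j) (f jj) ⊆ T f i (j + 1) := by
          intro x hx
          obtain ⟨hx, hxj⟩ := mem_relNbrs.1 hx
          obtain ⟨hxc, hxa⟩ := Finset.mem_filter.1 hx
          refine Finset.mem_filter.2 ⟨hxc, fun j' hj' h1 h2 => ?_⟩
          rcases Nat.lt_succ_iff_lt_or_eq.1 hj' with hlt | heq
          · exact hxa j' hlt h1 h2
          · have : j' = jj := Fin.ext heq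
            rwa [this]
        have h2 : (4 * Λ) ≤ (T f i j).card := by
          have h3 : (4 * Λ) ^ (j + 1) ≤ (4 * Λ) ^ (2 * s + 1) :=
            Nat.pow_le_pow_right (by omega) (by omega)
          have h4 := h3.trans ih
          rw [pow_succ, mul_comm] at h4
          exact Nat.le_of_mul_le_mul_right h4 (Nat.pow_pos (by omega))
        have h3 : (T f i j).card ≤ (relNbrs Gᶜ.Adj (T f i j) (f jj)).card * (4 * Λ) := by
          by_contra hcon
          exact hf2 i jj (Finset.mem_filter.2 ⟨Fintype.mem_piFinset.2 hfB, hji.1, hji.2, h2,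
            not_le.1 hcon⟩)
        calc (4 * Λ) ^ (2 * s + 1) ≤ (T f i j).card * (4 * Λ) ^ j := ih
          _ ≤ (T f i (j + 1)).card * (4 * Λ) * (4 * Λ) ^ j :=
            Nat.mul_le_mul_right _ (h3.trans (Nat.mul_le_mul_right _ (Finset.card_le_card h1)))
          _ = _ := by ring
      · have h1 : T f i j ⊆ T f i (j + 1) := by
          intro x hx
          obtain ⟨hxc, hxa⟩ := Finset.mem_filter.1 hx
          refine Finset.mem_filter.2 ⟨hxc, fun j' hj' h1 h2 => ?_⟩
          rcases Nat.lt_succ_iff_lt_or_eq.1 hj' with hlt | heq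
          · exact hxa j' hlt h1 h2
          · exact absurd ⟨(Fin.ext heq : j' = jj) ▸ h1, (Fin.ext heq : j' = jj) ▸ h2⟩ hji
        calc (4 * Λ) ^ (2 * s + 1) ≤ (T f i j).card * (4 * Λ) ^ j := ih
          _ ≤ (T f i (j + 1)).card * (4 * Λ) ^ (j + 1) := Nat.mul_le_mul (Finset.card_le_card h1)
            (Nat.pow_le_pow_right (by omega) (by omega))
  obtain ⟨a, haT, haind⟩ := h.exists_transversal hΛ s (fun i => T f i s) fun i => by
    have h1 := hTbig i s le_rfl
    rw [show 2 * s + 1 = (s + 1) + s by ring, pow_add] at h1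
    exact Nat.le_of_mul_le_mul_right h1 (Nat.pow_pos (by omega))
  let e : ℕ → Fin s := fun i => if hi : i < s then ⟨i, hi⟩ else ⟨0, by omega⟩
  have he : ∀ i, i < s → (e i).val = i := by
    intro i hi; simp only [e, dif_pos hi]
  have hinj : ∀ i < s, ∀ j < s, e i = e j → i = j := by
    intro i hi j hj hij
    rw [← he i hi, ← he j hj, hij]
  refine isIndContained_of_alternating (by omega) (fun i => a (e i)) (fun i => f (e i)) ?_ ?_ ?_
  · intro i hi j hj hadj
    by_cases hij : i = j
    · exact hadj.ne (by rw [hij])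
    · exact (hfind (e i) (e j) fun h => hij (hinj i hi j hj h)).2 hadj
  · intro i hi j hj hadj
    by_cases hij : i = j
    · exact hadj.ne (by rw [hij])
    · exact (haind (e i) (e j) fun h => hij (hinj i hi j hj h)).2 hadj
  · intro i hi j hj
    obtain ⟨hc, hav⟩ := Finset.mem_filter.1 (haT (e i))
    obtain ⟨_, hc1, hc2⟩ := mem_commonNbrs.1 hc
    have hval := Fin.val_add_one_eq (e i)
    rw [he i hi] at hval
    have hiff : (j = i ∨ j = i + 1 ∨ (i + 1 = s ∧ j = 0)) ↔ (e j = e i ∨ e j = e i + 1) := by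
      rw [Fin.ext_iff, Fin.ext_iff, hval, he i hi, he j hj]
      split_ifs <;> omega
    rw [hiff]
    constructor
    · intro hadj
      by_contra hcon
      push Not at hcon
      exact (hav (e j) (e j).isLt hcon.1 hcon.2).2 hadj.symm
    · rintro (h1 | h1)
      · rw [h1]; exact hc1.symm
      · rw [h1]; exact hc2.symm

/-! ### Random subsets -/

/-- The expected value of `φ S` for a random subset `S` of `B` that contains each element
independently with probability `p`. -/
noncomputable def sampleMean {V : Type*} (B : Finset V) (p : ℝ) (φ : Finset V → ℝ) : ℝ :=
  ∑ S ∈ B.powerset, p ^ S.card * (1 - p) ^ (B.card - S.card) * φ S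

open scoped Classical in
/-- The indicator function of `T ⊆ S`. -/
noncomputable def subsetInd {V : Type*} (T S : Finset V) : ℝ := if T ⊆ S then 1 else 0

theorem sampleMean_subsetInd {V : Type*} {B T : Finset V} (p : ℝ) (hT : T ⊆ B) :
    sampleMean B p (subsetInd T) = p ^ T.card := by
  classical
  have h := Finset.prod_add (fun _ : V => p) (fun i => if i ∈ T then 0 else 1 - p) B
  have h1 : ∏ i ∈ B, (p + if i ∈ T then 0 else 1 - p) = p ^ T.card := by
    rw [← Finset.prod_subset hT (f := fun i => (p + if i ∈ T then 0 else 1 - p))]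
    · rw [Finset.prod_congr rfl (g := fun _ => p) fun i hi => by simp [hi], Finset.prod_const]
    · intro i _ hi; simp [hi]
  rw [← h1, h, sampleMean]
  refine Finset.sum_congr rfl fun S hS => ?_
  have hSB := Finset.mem_powerset.1 hS
  rw [Finset.prod_const, mul_assoc]
  congr 1
  unfold subsetInd
  split_ifs with hTS
  · rw [Finset.prod_congr rfl (g := fun _ => 1 - p) fun i hi =>
      if_neg fun h => (Finset.mem_sdiff.1 hi).2 (hTS h), Finset.prod_const,
      Finset.card_sdiff_of_subset hSB, mul_one]
  · obtain ⟨i, hiT, hiS⟩ := Finset.not_subset.1 hTS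
    rw [mul_zero, Finset.prod_eq_zero (Finset.mem_sdiff.2 ⟨hT hiT, hiS⟩) (by simp [hiT])]

theorem sampleMean_subsetInd_le {V : Type*} {B : Finset V} {p : ℝ} (hp : 0 ≤ p) (T : Finset V) :
    sampleMean B p (subsetInd T) ≤ p ^ T.card := by
  by_cases hT : T ⊆ B
  · exact (sampleMean_subsetInd p hT).le
  · refine le_of_eq_of_le (Finset.sum_eq_zero fun S hS => ?_) (pow_nonneg hp _)
    rw [subsetInd, if_neg (fun h => hT (h.trans (Finset.mem_powerset.1 hS))), mul_zero]

theorem sampleMean_sub {V : Type*} (B : Finset V) (p : ℝ) (φ ψ : Finset V → ℝ) :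
    sampleMean B p (fun S => φ S - ψ S) = sampleMean B p φ - sampleMean B p ψ := by
  simp only [sampleMean, mul_sub, Finset.sum_sub_distrib]

theorem sampleMean_sum {V ι : Type*} (B : Finset V) (p : ℝ) (I : Finset ι)
    (φ : ι → Finset V → ℝ) :
    sampleMean B p (fun S => ∑ i ∈ I, φ i S) = ∑ i ∈ I, sampleMean B p (φ i) := by
  simp only [sampleMean, Finset.mul_sum]
  exact Finset.sum_comm

theorem sampleMean_const_mul {V : Type*} (B : Finset V) (p c : ℝ) (φ : Finset V → ℝ) :
    sampleMean B p (fun S => c * φ S) = c * sampleMean B p φ := by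
  simp only [sampleMean, Finset.mul_sum]
  exact Finset.sum_congr rfl fun S _ => by ring

theorem exists_pos_of_sampleMean_pos {V : Type*} {B : Finset V} {p : ℝ} (hp : 0 ≤ p) (hp1 : p ≤ 1)
    {φ : Finset V → ℝ} (h : 0 < sampleMean B p φ) : ∃ S ⊆ B, 0 < φ S := by
  by_contra hcon
  push Not at hcon
  refine absurd h (not_lt.2 (Finset.sum_nonpos fun S hS => ?_))
  exact mul_nonpos_of_nonneg_of_nonpos
    (mul_nonneg (pow_nonneg hp _) (pow_nonneg (by linarith) _)) (hcon S (Finset.mem_powerset.1 hS))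

/-! ### Cherry systems and induced subdivisions -/

/-- A system of cherries in `G` with end points in `B`: a member `(a, e)` consists of a pair `e` of
nonadjacent vertices of `B` and of a common neighbour `a` of the two, and each pair is used by at
most one member. -/
structure IsCherrySystem {V : Type*} (G : SimpleGraph V) (B : Finset V)
    (P : Finset (V × Finset V)) : Prop where
  subset : ∀ q ∈ P, q.2 ⊆ B
  card_eq : ∀ q ∈ P, q.2.card = 2
  adj : ∀ q ∈ P, ∀ x ∈ q.2, G.Adj q.1 x
  not_adj : ∀ q ∈ P, ∀ x ∈ q.2, ∀ y ∈ q.2, ¬ G.Adj x y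
  unique : ∀ q ∈ P, ∀ q' ∈ P, q.2 = q'.2 → q = q'

/-- The pairs of a cherry system, considered as the edges of a graph. -/
def cherryRel {V : Type*} [DecidableEq V] (P : Finset (V × Finset V)) (x y : V) : Prop :=
  x ≠ y ∧ ∃ q ∈ P, q.2 = {x, y}

theorem cherryRel_symm {V : Type*} [DecidableEq V] {P : Finset (V × Finset V)} {x y : V}
    (h : cherryRel P x y) : cherryRel P y x := by
  obtain ⟨hne, q, hq, he⟩ := h
  exact ⟨hne.symm, q, hq, by rw [he, Finset.pair_comm]⟩

/-- A cherry system with more than `t |S|` members, in which the vertices of `S` that are end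
points and the centres are independent and each centre sees only its own two end points inside
`S`, contains an induced cycle: it is the subdivision of a cycle in the graph formed by the
pairs. -/
theorem IsCherrySystem.isIndContained_of_card {V : Type*} [DecidableEq V] {G : SimpleGraph V}
    {S : Finset V} {P : Finset (V × Finset V)} (hP : IsCherrySystem G S P) {t : ℕ} (ht : 1 ≤ t)
    (hcard : t * S.card < P.card)
    (hends : ∀ q ∈ P, ∀ q' ∈ P, ∀ x ∈ q.2, ∀ y ∈ q'.2, ¬ G.Adj x y)
    (hcentres : ∀ q ∈ P, ∀ q' ∈ P, ¬ G.Adj q.1 q'.1)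
    (htrace : ∀ q ∈ P, ∀ x ∈ S, G.Adj q.1 x → x ∈ q.2) :
    ∃ n, t + 2 ≤ n ∧ (SimpleGraph.cycleGraph (2 * n)).IsIndContained G := by
  have hnd : ¬ IsDegenerateOn (cherryRel P) S t := by
    intro hdeg
    obtain ⟨β, hβ1, _, hβ3⟩ := hdeg.exists_orientation fun x y => cherryRel_symm
    have hsub : P.image Prod.snd ⊆ (S.sigma β).image fun z => {z.1, z.2} := by
      intro e he
      obtain ⟨q, hq, rfl⟩ := Finset.mem_image.1 he
      obtain ⟨x, y, hxy, hqe⟩ := Finset.card_eq_two.1 (hP.card_eq q hq)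
      have hxS : x ∈ S := hP.subset q hq (by simp [hqe])
      have hyS : y ∈ S := hP.subset q hq (by simp [hqe])
      rcases hβ3 x hxS y hyS ⟨hxy, q, hq, hqe⟩ with h | h
      · exact Finset.mem_image.2 ⟨⟨x, y⟩, Finset.mem_sigma.2 ⟨hxS, h⟩, hqe.symm⟩
      · exact Finset.mem_image.2 ⟨⟨y, x⟩, Finset.mem_sigma.2 ⟨hyS, h⟩, by
          rw [hqe, Finset.pair_comm]⟩
    have h1 : P.card ≤ (S.sigma β).card := by
      rw [← Finset.card_image_of_injOn (f := Prod.snd) (s := P)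
        fun q hq q' hq' h => hP.unique q hq q' hq' h]
      exact (Finset.card_le_card hsub).trans Finset.card_image_le
    rw [Finset.card_sigma] at h1
    have h2 : ∑ x ∈ S, (β x).card ≤ S.card * t := by
      simpa using Finset.sum_le_card_nsmul S (fun x => (β x).card) t fun x _ => hβ1 x
    rw [mul_comm] at h2
    omega
  unfold IsDegenerateOn at hnd
  push Not at hnd
  obtain ⟨W, hWS, hWne, hW⟩ := hnd
  obtain ⟨n, c, hn, hcW, hcinj, hcR, hcl⟩ :=
    exists_cycle_of_min_degree (R := cherryRel P) (fun x y => cherryRel_symm) (fun x h => h.1 rfl)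
      hWne hW
  refine ⟨n, hn, ?_⟩
  have hq : ∀ i, ∃ q : V × Finset V, i < n → q ∈ P ∧
      q.2 = {c i, if i + 1 = n then c 0 else c (i + 1)} := by
    intro i
    by_cases hi : i + 1 < n
    · obtain ⟨_, q, hqP, hqe⟩ := hcR i hi
      exact ⟨q, fun _ => ⟨hqP, by rw [if_neg (by omega), hqe]⟩⟩
    · obtain ⟨_, q, hqP, hqe⟩ := hcl
      refine ⟨q, fun hin => ⟨hqP, ?_⟩⟩
      have : i = n - 1 := by omega
      rw [if_pos (by omega), hqe, this]
  choose q hq using hq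
  have hcq : ∀ i < n, c i ∈ (q i).2 := fun i hi => by simp [(hq i hi).2]
  refine isIndContained_of_alternating (by omega) (fun i => (q i).1) c ?_ ?_ ?_
  · exact fun i hi j hj => hends _ (hq i hi).1 _ (hq j hj).1 _ (hcq i hi) _ (hcq j hj)
  · exact fun i hi j hj => hcentres _ (hq i hi).1 _ (hq j hj).1
  · intro i hi j hj
    have hiff : G.Adj (q i).1 (c j) ↔ c j ∈ (q i).2 :=
      ⟨htrace _ (hq i hi).1 _ (hWS (hcW j hj)), hP.adj _ (hq i hi).1 _⟩
    rw [hiff, (hq i hi).2, Finset.mem_insert, Finset.mem_singleton]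
    constructor
    · rintro (h | h)
      · exact Or.inl (hcinj j hj i hi h)
      · split_ifs at h with hin
        · exact Or.inr (Or.inr ⟨hin, hcinj j hj 0 (by omega) h⟩)
        · exact Or.inr (Or.inl (hcinj j hj _ (by omega) h))
    · rintro (h | h | ⟨h1, h2⟩)
      · exact Or.inl (by rw [h])
      · refine Or.inr ?_
        rw [if_neg (by omega), h]
      · refine Or.inr ?_
        rw [if_pos h1, h2]

open scoped Classical in
/-- The pairs of members `(a, e)`, `(a', e')` of a cherry system with `a'` an out-neighbour
of `a`. -/
noncomputable def centreConflicts {V : Type*} (β : V → Finset V) (P : Finset (V × Finset V)) :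
    Finset ((V × Finset V) × (V × Finset V)) :=
  (P ×ˢ P).filter fun z => z.2.1 ∈ β z.1.1

open scoped Classical in
/-- The sampling step. A random subset `S` of `B` of density `p` isolates many members of a large
cherry system: both end points are in `S`, no other neighbour of the centre is, nor any
out-neighbour of the end points. If few conflicts between the centres are to be expected, what
remains after their deletion is an induced subdivision of a graph with more than `t |S|` edges on
`S`. -/
theorem IsCherrySystem.isIndContained_of_sample {V : Type*} {G : SimpleGraph V}
    {B U : Finset V} {P : Finset (V × Finset V)} (hP : IsCherrySystem G B P) (hBU : B ⊆ U)
    (hPU : ∀ q ∈ P, q.1 ∈ U) {β : V → Finset V} {k Δ M τ p : ℝ}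
    (hβcard : ∀ v, ((β v).card : ℝ) ≤ k) (hβadj : ∀ v, ∀ x ∈ β v, G.Adj v x)
    (hβ : ∀ x ∈ U, ∀ y ∈ U, G.Adj x y → y ∈ β x ∨ x ∈ β y)
    (hΔ : ∀ q ∈ P, ((relNbrs G.Adj B q.1).card : ℝ) ≤ Δ)
    (hM : ∀ a, ((P.filter fun q => q.1 = a).card : ℝ) ≤ M)
    (hτ : (((centreConflicts β P).filter fun z => ¬ Disjoint z.1.2 z.2.2).card : ℝ) ≤ τ * P.card)
    (hp : 0 < p) (hp1 : p ≤ 1) (hpΔ : p * (Δ + 2 * k) ≤ 1 / 2) (hpM : k * M * p ^ 2 ≤ 1 / 8)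
    (hpτ : τ * p ≤ 1 / 8) {t : ℕ} (ht : 1 ≤ t) (hcard : 4 * t * B.card < p * P.card) :
    ∃ n, t + 2 ≤ n ∧ (SimpleGraph.cycleGraph (2 * n)).IsIndContained G := by
  let F : V × Finset V → Finset V := fun q => (relNbrs G.Adj B q.1 \ q.2) ∪ q.2.biUnion β
  have hFcard : ∀ q ∈ P, ((F q).card : ℝ) ≤ Δ + 2 * k := by
    intro q hq
    have h1 : (F q).card ≤ (relNbrs G.Adj B q.1).card + ∑ x ∈ q.2, (β x).card :=
      (Finset.card_union_le _ _).trans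
        (add_le_add (Finset.card_le_card Finset.sdiff_subset) Finset.card_biUnion_le)
    have h2 : ∑ x ∈ q.2, ((β x).card : ℝ) ≤ 2 * k := by
      have := Finset.sum_le_card_nsmul q.2 (fun x => ((β x).card : ℝ)) k fun x _ => hβcard x
      rwa [hP.card_eq q hq, nsmul_eq_mul, Nat.cast_ofNat] at this
    have h3 : ((F q).card : ℝ) ≤ (relNbrs G.Adj B q.1).card + ∑ x ∈ q.2, ((β x).card : ℝ) := by
      exact_mod_cast h1
    linarith [hΔ q hq]
  have hFe : ∀ q ∈ P, ∀ x ∈ F q, x ∉ q.2 := by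
    intro q hq x hx hxe
    rcases Finset.mem_union.1 hx with h | h
    · exact (Finset.mem_sdiff.1 h).2 hxe
    · obtain ⟨y, hy, hyx⟩ := Finset.mem_biUnion.1 h
      exact hP.not_adj q hq y hy x hxe (hβadj y x hyx)
  set C := centreConflicts β P with hC
  have hCmem : ∀ z ∈ C, z.1 ∈ P ∧ z.2 ∈ P ∧ z.2.1 ∈ β z.1.1 := by
    intro z hz
    obtain ⟨h1, h2⟩ := Finset.mem_filter.1 hz
    exact ⟨(Finset.mem_product.1 h1).1, (Finset.mem_product.1 h1).2, h2⟩
  have hCcard : (C.card : ℝ) ≤ P.card * (k * M) := by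
    have h1 : C.card = ∑ q ∈ P, ((P.filter fun q' => q'.1 ∈ β q.1).card) := by
      rw [hC, centreConflicts, Finset.card_filter, Finset.sum_product]
      exact Finset.sum_congr rfl fun q _ => (Finset.card_filter _ _).symm
    rw [h1, Nat.cast_sum, ← nsmul_eq_mul]
    refine Finset.sum_le_card_nsmul _ _ _ fun q _ => ?_
    have h2 : (P.filter fun q' => q'.1 ∈ β q.1).card ≤
        ∑ a ∈ β q.1, (P.filter fun q' => q'.1 = a).card := by
      refine (Finset.card_le_card fun q' hq' => ?_).trans Finset.card_biUnion_le
      obtain ⟨h1, h2⟩ := Finset.mem_filter.1 hq'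
      exact Finset.mem_biUnion.2 ⟨_, h2, Finset.mem_filter.2 ⟨h1, rfl⟩⟩
    have h3 : ∑ a ∈ β q.1, ((P.filter fun q' => q'.1 = a).card : ℝ) ≤ (β q.1).card * M := by
      rw [← nsmul_eq_mul]
      exact Finset.sum_le_card_nsmul _ _ _ fun a _ => hM a
    have hM0 : 0 ≤ M := (Nat.cast_nonneg _).trans (hM q.1)
    calc ((P.filter fun q' => q'.1 ∈ β q.1).card : ℝ)
        ≤ ∑ a ∈ β q.1, ((P.filter fun q' => q'.1 = a).card : ℝ) := by exact_mod_cast h2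
      _ ≤ (β q.1).card * M := h3
      _ ≤ k * M := mul_le_mul_of_nonneg_right (hβcard _) hM0
  -- the number of isolated members, of conflicts among them and of sampled vertices
  let φ : Finset V → ℝ := fun S =>
    ((∑ q ∈ P, (subsetInd q.2 S - ∑ x ∈ F q, subsetInd (insert x q.2) S)) -
      ∑ z ∈ C, subsetInd (z.1.2 ∪ z.2.2) S) - t * ∑ x ∈ B, subsetInd {x} S
  have hmean : 0 < sampleMean B p φ := by
    simp only [φ]
    rw [sampleMean_sub, sampleMean_sub, sampleMean_const_mul, sampleMean_sum, sampleMean_sum,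
      sampleMean_sum]
    have h1 : P.card * (p ^ 2 / 2) ≤ ∑ q ∈ P, sampleMean B p fun S =>
        (subsetInd q.2 S - ∑ x ∈ F q, subsetInd (insert x q.2) S) := by
      rw [← nsmul_eq_mul]
      refine Finset.card_nsmul_le_sum _ _ _ fun q hq => ?_
      rw [sampleMean_sub, sampleMean_sum, sampleMean_subsetInd p (hP.subset q hq), hP.card_eq q hq]
      have h2 : ∑ x ∈ F q, sampleMean B p (fun S => subsetInd (insert x q.2) S) ≤
          (F q).card * p ^ 3 := by
        rw [← nsmul_eq_mul]
        refine Finset.sum_le_card_nsmul _ _ _ fun x hx => ?_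
        refine (sampleMean_subsetInd_le hp.le _).trans (le_of_eq ?_)
        rw [Finset.card_insert_of_notMem (hFe q hq x hx), hP.card_eq q hq]
      have h3 : (F q).card * p ^ 3 ≤ p ^ 2 / 2 := by
        have h4 : p * (F q).card ≤ 1 / 2 :=
          (mul_le_mul_of_nonneg_left (hFcard q hq) hp.le).trans hpΔ
        calc (F q).card * p ^ 3 = (p * (F q).card) * p ^ 2 := by ring
          _ ≤ 1 / 2 * p ^ 2 := mul_le_mul_of_nonneg_right h4 (by positivity)
          _ = _ := by ring
      linarith
    have h2 : ∑ z ∈ C, sampleMean B p (fun S => subsetInd (z.1.2 ∪ z.2.2) S) ≤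
        P.card * (p ^ 2 / 4) := by
      rw [← Finset.sum_filter_add_sum_filter_not C fun z => Disjoint z.1.2 z.2.2]
      have h3 : ∑ z ∈ C.filter (fun z => Disjoint z.1.2 z.2.2),
          sampleMean B p (fun S => subsetInd (z.1.2 ∪ z.2.2) S) ≤ P.card * (p ^ 2 / 8) := by
        calc _ ≤ ∑ z ∈ C.filter (fun z => Disjoint z.1.2 z.2.2), p ^ 4 := by
              refine Finset.sum_le_sum fun z hz => ?_
              obtain ⟨hz, hdis⟩ := Finset.mem_filter.1 hz
              obtain ⟨hz1, hz2, _⟩ := hCmem z hz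
              refine (sampleMean_subsetInd_le hp.le _).trans (le_of_eq ?_)
              rw [Finset.card_union_of_disjoint hdis, hP.card_eq _ hz1, hP.card_eq _ hz2]
          _ ≤ P.card * (k * M) * p ^ 4 := by
              rw [Finset.sum_const, nsmul_eq_mul]
              refine mul_le_mul_of_nonneg_right (le_trans ?_ hCcard) (by positivity)
              exact_mod_cast Finset.card_filter_le _ _
          _ = P.card * p ^ 2 * (k * M * p ^ 2) := by ring
          _ ≤ P.card * p ^ 2 * (1 / 8) := mul_le_mul_of_nonneg_left hpM (by positivity)
          _ = _ := by ring
      have h4 : ∑ z ∈ C.filter (fun z => ¬ Disjoint z.1.2 z.2.2),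
          sampleMean B p (fun S => subsetInd (z.1.2 ∪ z.2.2) S) ≤ P.card * (p ^ 2 / 8) := by
        calc _ ≤ ∑ z ∈ C.filter (fun z => ¬ Disjoint z.1.2 z.2.2), p ^ 3 := by
              refine Finset.sum_le_sum fun z hz => ?_
              obtain ⟨hz, hdis⟩ := Finset.mem_filter.1 hz
              obtain ⟨hz1, hz2, hz3⟩ := hCmem z hz
              refine (sampleMean_subsetInd_le hp.le _).trans
                (pow_le_pow_of_le_one hp.le hp1 ?_)
              -- the two pairs are distinct, as their centres are
              have hne : z.1.2 ≠ z.2.2 := fun h =>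
                (hβadj _ _ hz3).ne (congrArg Prod.fst (hP.unique _ hz1 _ hz2 h))
              by_contra hlt
              have h5 : z.1.2 = z.1.2 ∪ z.2.2 := Finset.eq_of_subset_of_card_le
                Finset.subset_union_left (by rw [hP.card_eq _ hz1]; omega)
              have h6 : z.2.2 = z.1.2 ∪ z.2.2 := Finset.eq_of_subset_of_card_le
                Finset.subset_union_right (by rw [hP.card_eq _ hz2]; omega)
              exact hne (h5.trans h6.symm)
          _ ≤ τ * P.card * p ^ 3 := by
              rw [Finset.sum_const, nsmul_eq_mul]
              exact mul_le_mul_of_nonneg_right hτ (by positivity)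
          _ = P.card * p ^ 2 * (τ * p) := by ring
          _ ≤ P.card * p ^ 2 * (1 / 8) := mul_le_mul_of_nonneg_left hpτ (by positivity)
          _ = _ := by ring
      linarith
    have h3 : ∑ x ∈ B, sampleMean B p (fun S => subsetInd {x} S) = B.card * p := by
      rw [← nsmul_eq_mul]
      refine Finset.sum_eq_card_nsmul fun x hx => ?_
      refine (sampleMean_subsetInd p (Finset.singleton_subset_iff.2 hx)).trans ?_
      simp
    rw [h3]
    have h4 : 0 < p * (p * P.card - 4 * t * B.card) := mul_pos hp (by linarith)
    nlinarith
  obtain ⟨S, hSB, hS⟩ := exists_pos_of_sampleMean_pos hp.le hp1 hmean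
  let R := P.filter fun q => q.2 ⊆ S ∧ ∀ x ∈ F q, x ∉ S
  let R' := R.filter fun q => ∀ q' ∈ R, q'.1 ∉ β q.1
  have hRP : ∀ q ∈ R, q ∈ P := fun q hq => (Finset.mem_filter.1 hq).1
  have hR'R : ∀ q ∈ R', q ∈ R := fun q hq => (Finset.mem_filter.1 hq).1
  have hR : ∑ q ∈ P, (subsetInd q.2 S - ∑ x ∈ F q, subsetInd (insert x q.2) S) ≤ R.card := by
    rw [Finset.card_filter, Nat.cast_sum]
    refine Finset.sum_le_sum fun q _ => ?_
    have hnn : ∀ x ∈ F q, 0 ≤ subsetInd (insert x q.2) S := fun x _ => by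
      unfold subsetInd; split_ifs <;> norm_num
    by_cases hqS : q.2 ⊆ S
    · by_cases hqF : ∀ x ∈ F q, x ∉ S
      · rw [if_pos ⟨hqS, hqF⟩]
        have := Finset.sum_nonneg hnn
        have h2 : subsetInd q.2 S = 1 := by rw [subsetInd, if_pos hqS]
        push_cast
        linarith
      · rw [if_neg fun h => hqF h.2]
        push Not at hqF
        obtain ⟨x, hx, hxS⟩ := hqF
        have h1 := Finset.single_le_sum hnn hx
        have h2 : subsetInd q.2 S = 1 := by rw [subsetInd, if_pos hqS]
        have h3 : subsetInd (insert x q.2) S = 1 := by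
          rw [subsetInd, if_pos (Finset.insert_subset hxS hqS)]
        push_cast
        linarith
    · rw [if_neg fun h => hqS h.1]
      have := Finset.sum_nonneg hnn
      have h2 : subsetInd q.2 S = 0 := by rw [subsetInd, if_neg hqS]
      push_cast
      linarith
  have hconf : (((R \ R').card : ℕ) : ℝ) ≤ ∑ z ∈ C, subsetInd (z.1.2 ∪ z.2.2) S := by
    have h1 : ∑ z ∈ C, subsetInd (z.1.2 ∪ z.2.2) S =
        ((C.filter fun z => z.1.2 ∪ z.2.2 ⊆ S).card : ℝ) := by
      rw [Finset.card_filter, Nat.cast_sum]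
      refine Finset.sum_congr rfl fun z _ => ?_
      unfold subsetInd
      split_ifs <;> simp
    rw [h1]
    have h2 : R \ R' ⊆ (C.filter fun z => z.1.2 ∪ z.2.2 ⊆ S).image Prod.fst := by
      intro q hq
      obtain ⟨hqR, hqR'⟩ := Finset.mem_sdiff.1 hq
      have h3 : ¬ ∀ q' ∈ R, q'.1 ∉ β q.1 := fun h => hqR' (Finset.mem_filter.2 ⟨hqR, h⟩)
      push Not at h3
      obtain ⟨q', hq', hqq'⟩ := h3
      refine Finset.mem_image.2 ⟨(q, q'), Finset.mem_filter.2 ⟨Finset.mem_filter.2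
        ⟨Finset.mem_product.2 ⟨hRP q hqR, hRP q' hq'⟩, hqq'⟩, ?_⟩, rfl⟩
      exact Finset.union_subset (Finset.mem_filter.1 hqR).2.1 (Finset.mem_filter.1 hq').2.1
    exact_mod_cast (Finset.card_le_card h2).trans Finset.card_image_le
  have hScard : ∑ x ∈ B, subsetInd {x} S = (S.card : ℝ) := by
    have : S = B.filter fun x => x ∈ S := by
      ext x; simp only [Finset.mem_filter]; exact ⟨fun h => ⟨hSB h, h⟩, fun h => h.2⟩
    conv_rhs => rw [this]
    rw [Finset.card_filter, Nat.cast_sum]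
    refine Finset.sum_congr rfl fun x _ => ?_
    simp [subsetInd]
  have hR'card : t * S.card < R'.card := by
    have h1 : (R \ R').card + R'.card = R.card :=
      Finset.card_sdiff_add_card_eq_card (Finset.filter_subset _ _)
    have h2 : ((R \ R').card : ℝ) + R'.card = R.card := by exact_mod_cast h1
    have h3 : (t : ℝ) * S.card < R'.card := by
      simp only [φ, hScard] at hS
      linarith
    exact_mod_cast h3
  have hR'P : ∀ q ∈ R', q ∈ P := fun q hq => hRP q (hR'R q hq)
  have hout : ∀ q ∈ R', ∀ x ∈ q.2, ∀ y ∈ S, y ∉ β x := fun q hq x hx y hy hyx =>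
    (Finset.mem_filter.1 (hR'R q hq)).2.2 y
      (Finset.mem_union_right _ (Finset.mem_biUnion.2 ⟨x, hx, hyx⟩)) hy
  have hR'S : ∀ q ∈ R', q.2 ⊆ S := fun q hq => (Finset.mem_filter.1 (hR'R q hq)).2.1
  have hR'sys : IsCherrySystem G S R' :=
    ⟨hR'S, fun q hq => hP.card_eq q (hR'P q hq), fun q hq => hP.adj q (hR'P q hq),
      fun q hq => hP.not_adj q (hR'P q hq),
      fun q hq q' hq' => hP.unique q (hR'P q hq) q' (hR'P q' hq')⟩
  refine hR'sys.isIndContained_of_card ht hR'card ?_ ?_ ?_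
  · intro q hq q' hq' x hx y hy hxy
    have hxS := hR'S q hq hx
    have hyS := hR'S q' hq' hy
    rcases hβ x (hBU (hSB hxS)) y (hBU (hSB hyS)) hxy with h | h
    · exact hout q hq x hx y hyS h
    · exact hout q' hq' y hy x hxS h
  · intro q hq q' hq' hadj
    rcases hβ _ (hPU q (hR'P q hq)) _ (hPU q' (hR'P q' hq')) hadj with h | h
    · exact (Finset.mem_filter.1 hq).2 q' (hR'R q' hq') h
    · exact (Finset.mem_filter.1 hq').2 q (hR'R q hq) h
  · intro q hq x hxS hadj
    by_contra hxe
    exact (Finset.mem_filter.1 (hR'R q hq)).2.2 x (Finset.mem_union_left _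
      (Finset.mem_sdiff.2 ⟨mem_relNbrs.2 ⟨hSB hxS, hadj⟩, hxe⟩)) hxS

/-! ### Existence of large cherry systems -/

/-- If no set of at most `2 k` vertices spans more than `4 k² / Λ` adjacent ordered pairs, then a
set `Y` of at most `k` vertices receives few edges from any set `X`, however large. -/
theorem sum_relNbrs_le_of_sparse {V : Type*} {G : SimpleGraph V} {k Λ : ℝ} (hk : 1 ≤ k)
    (hΛ : 0 < Λ) (hsparse : ∀ W : Finset V, (W.card : ℝ) ≤ 2 * k →
      adjPairs G.Adj W * Λ ≤ 4 * k ^ 2) {X Y : Finset V} (hY : (Y.card : ℝ) ≤ k) :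
    ∑ a ∈ X, ((relNbrs G.Adj Y a).card : ℝ) ≤ X.card * (8 * k / Λ) + 4 * k ^ 2 / Λ := by
  classical
  have hZ : ∀ Z : Finset V, (Z.card : ℝ) ≤ k →
      ∑ a ∈ Z, ((relNbrs G.Adj Y a).card : ℝ) ≤ 4 * k ^ 2 / Λ := by
    intro Z hZ
    rw [le_div_iff₀ hΛ]
    refine le_trans (mul_le_mul_of_nonneg_right ?_ hΛ.le) (hsparse (Z ∪ Y) ?_)
    · have : ∑ a ∈ Z, (relNbrs G.Adj Y a).card ≤ adjPairs G.Adj (Z ∪ Y) :=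
        (Finset.sum_le_sum fun a _ => Finset.card_le_card
          (relNbrs_mono _ Finset.subset_union_right a)).trans
          (Finset.sum_le_sum_of_subset Finset.subset_union_left)
      exact_mod_cast this
    · have : ((Z ∪ Y).card : ℝ) ≤ Z.card + Y.card := by exact_mod_cast Finset.card_union_le _ _
      linarith
  have hk0 : 0 < k := by linarith
  let Xh := X.filter fun a => 8 * k / Λ < (relNbrs G.Adj Y a).card
  have hXh : (Xh.card : ℝ) ≤ k := by
    by_contra hcon
    push Not at hcon
    have h1 : ⌊k⌋₊ ≤ Xh.card := Nat.floor_le_of_le hcon.le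
    obtain ⟨Z, hZX, hZc⟩ := Finset.exists_subset_card_eq h1
    have h2 := hZ Z (by rw [hZc]; exact Nat.floor_le hk0.le)
    have h3 : (Z.card : ℝ) * (8 * k / Λ) ≤ ∑ a ∈ Z, ((relNbrs G.Adj Y a).card : ℝ) := by
      rw [← nsmul_eq_mul]
      exact Finset.card_nsmul_le_sum _ _ _ fun a ha => (Finset.mem_filter.1 (hZX ha)).2.le
    have h4 : k / 2 < Z.card := by
      rw [hZc]
      have h5 := Nat.lt_floor_add_one k
      have h6 : (1 : ℝ) ≤ ⌊k⌋₊ := by exact_mod_cast Nat.one_le_floor_iff k |>.2 hk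
      linarith
    have h5 : k / 2 * (8 * k / Λ) < Z.card * (8 * k / Λ) :=
      mul_lt_mul_of_pos_right h4 (by positivity)
    have h6 : k / 2 * (8 * k / Λ) = 4 * k ^ 2 / Λ := by ring
    linarith
  rw [← Finset.sum_filter_add_sum_filter_not X fun a => 8 * k / Λ < (relNbrs G.Adj Y a).card]
  have h1 := hZ Xh hXh
  have h2 : ∑ a ∈ X.filter (fun a => ¬ 8 * k / Λ < (relNbrs G.Adj Y a).card),
      ((relNbrs G.Adj Y a).card : ℝ) ≤ X.card * (8 * k / Λ) := by
    refine (Finset.sum_le_card_nsmul _ _ (8 * k / Λ) fun a ha =>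
      not_lt.1 (Finset.mem_filter.1 ha).2).trans ?_
    rw [nsmul_eq_mul]
    refine mul_le_mul_of_nonneg_right ?_ (by positivity)
    exact_mod_cast Finset.card_filter_le _ _
  linarith

theorem adjPairs_cherryRel_le {V : Type*} [DecidableEq V] {P : Finset (V × Finset V)}
    (hP : ∀ q ∈ P, q.2.card = 2) (W : Finset V) :
    adjPairs (cherryRel P) W ≤ 2 * (P.filter fun q => q.2 ⊆ W).card := by
  rw [adjPairs, ← Finset.card_sigma, mul_comm]
  have h1 : ((W.sigma fun x => relNbrs (cherryRel P) W x).image fun z => (z.1, z.2)) ⊆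
      (P.filter fun q => q.2 ⊆ W).biUnion fun q => q.2.offDiag := by
    intro z hz
    obtain ⟨⟨x, y⟩, hxy, rfl⟩ := Finset.mem_image.1 hz
    obtain ⟨hx, hy⟩ := Finset.mem_sigma.1 hxy
    obtain ⟨hy, hne, q, hq, hqe⟩ := mem_relNbrs.1 hy
    refine Finset.mem_biUnion.2 ⟨q, Finset.mem_filter.2 ⟨hq, ?_⟩, ?_⟩
    · rw [hqe]
      exact Finset.insert_subset hx (Finset.singleton_subset_iff.2 hy)
    · rw [hqe]
      exact Finset.mem_offDiag.2 ⟨by simp, by simp, hne⟩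
  rw [← Finset.card_image_of_injective (f := fun z : (_ : V) × V => (z.1, z.2))]
  · refine (Finset.card_le_card h1).trans (Finset.card_biUnion_le.trans ?_)
    refine (Finset.sum_le_card_nsmul _ _ 2 fun q hq => ?_).trans (by simp)
    rw [Finset.offDiag_card, hP q (Finset.mem_filter.1 hq).1]
  · rintro ⟨x, y⟩ ⟨x', y'⟩ h
    simp only [Prod.mk.injEq] at h
    obtain ⟨rfl, rfl⟩ := h
    rfl

/-- In an orientation, a clique `U` contains at least half of its ordered pairs as arcs. -/
theorem card_mul_card_le_sum_orientation {V : Type*} [DecidableEq V] {U : Finset V}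
    {β : V → Finset V} (h : ∀ x ∈ U, ∀ y ∈ U, x ≠ y → y ∈ β x ∨ x ∈ β y) :
    U.card * U.card ≤ U.card + 2 * ∑ x ∈ U, (β x ∩ U).card := by
  have h1 : U.offDiag ⊆ ((U.sigma fun x => β x ∩ U).image fun z => (z.1, z.2)) ∪
      ((U.sigma fun x => β x ∩ U).image fun z => (z.2, z.1)) := by
    rintro ⟨x, y⟩ hxy
    obtain ⟨hx, hy, hne⟩ := Finset.mem_offDiag.1 hxy
    rcases h x hx y hy hne with hβ | hβ
    · exact Finset.mem_union_left _ (Finset.mem_image.2 ⟨⟨x, y⟩,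
        Finset.mem_sigma.2 ⟨hx, Finset.mem_inter.2 ⟨hβ, hy⟩⟩, rfl⟩)
    · exact Finset.mem_union_right _ (Finset.mem_image.2 ⟨⟨y, x⟩,
        Finset.mem_sigma.2 ⟨hy, Finset.mem_inter.2 ⟨hβ, hx⟩⟩, rfl⟩)
  have h2 := (Finset.card_le_card h1).trans ((Finset.card_union_le _ _).trans
    (add_le_add Finset.card_image_le Finset.card_image_le))
  rw [Finset.offDiag_card, Finset.card_sigma] at h2
  omega

open scoped Classical in
/-- Let every vertex of `A` have at least `δ` neighbours in `B`, where `|A| ≥ ρ |B|`. In a graph of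
bounded average degree which is sparse on sets of `2 k` vertices, some nonempty `B₀ ⊆ B` carries a
cherry system with centres in `A` and at least `μ |B₀|` members, in which no centre `a` uses a
vertex `b` more than `r` times.

To see this, take a maximal system on `B`. If it has few members on every subset, then
together with the edges of `G` it forms a degenerate graph `H` on `B`. Most centres then have a large
set of neighbours that they do not use `r` times, which by maximality is a clique of `H`; the
out-neighbourhoods of an orientation of `H` now receive too many edges from `A`. -/
theorem exists_isCherrySystem {V : Type*} {G : SimpleGraph V} {A B : Finset V} (hB : B.Nonempty)
    {r : ℕ} (hr : 1 ≤ r) {δ ρ D μ k Λ : ℝ} (hΛ : 0 < Λ)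
    (hk : 1 ≤ k) (hdeg : ∀ a ∈ A, δ ≤ (relNbrs G.Adj B a).card)
    (hAB : ρ * B.card ≤ A.card) (hD : ∀ W ⊆ B, (adjPairs G.Adj W : ℝ) ≤ D * W.card)
    (hkD : D + 2 * μ ≤ k)
    (hsparse : ∀ W : Finset V, (W.card : ℝ) ≤ 2 * k → adjPairs G.Adj W * Λ ≤ 4 * k ^ 2)
    (hμ : μ ≤ r * δ * ρ / 8) (hδ : 1 + 16 * k / Λ ≤ δ / 4) (hk2 : 128 * k ^ 2 < Λ * ρ * δ ^ 2) :
    ∃ B₀ ⊆ B, B₀.Nonempty ∧ ∃ P, IsCherrySystem G B₀ P ∧ (∀ q ∈ P, q.1 ∈ A) ∧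
      (∀ a b, (P.filter fun q => q.1 = a ∧ b ∈ q.2).card ≤ r) ∧ μ * B₀.card ≤ P.card := by
  let Good : Finset (V × Finset V) → Prop := fun P =>
    IsCherrySystem G B P ∧ ∀ a b, (P.filter fun q => q.1 = a ∧ b ∈ q.2).card ≤ r
  obtain ⟨P, hPmax⟩ : ∃ P, Maximal
      (· ∈ ((A ×ˢ B.powerset).powerset.filter Good)) P := by
    refine Finset.exists_maximal ⟨∅, Finset.mem_filter.2 ⟨by simp, ⟨?_, by simp⟩⟩⟩
    constructor <;> simp
  obtain ⟨hPsub, hP, hPr⟩ := Finset.mem_filter.1 hPmax.1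
  have hPA : ∀ q ∈ P, q.1 ∈ A := fun q hq =>
    (Finset.mem_product.1 (Finset.mem_powerset.1 hPsub hq)).1
  by_contra hcon
  have hfew : ∀ W ⊆ B, W.Nonempty → ((P.filter fun q => q.2 ⊆ W).card : ℝ) < μ * W.card := by
    intro W hW hWne
    by_contra hlt
    refine hcon ⟨W, hW, hWne, P.filter fun q => q.2 ⊆ W, ?_, ?_, ?_, not_lt.1 hlt⟩
    · have hs : ∀ q ∈ P.filter (fun q => q.2 ⊆ W), q ∈ P := fun q hq => (Finset.mem_filter.1 hq).1
      exact ⟨fun q hq => (Finset.mem_filter.1 hq).2, fun q hq => hP.card_eq q (hs q hq),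
        fun q hq => hP.adj q (hs q hq), fun q hq => hP.not_adj q (hs q hq),
        fun q hq q' hq' => hP.unique q (hs q hq) q' (hs q' hq')⟩
    · exact fun q hq => hPA q (Finset.mem_filter.1 hq).1
    · exact fun a b => (Finset.card_le_card
        (Finset.filter_subset_filter _ (Finset.filter_subset _ _))).trans (hPr a b)
  -- the graph formed by `G` and the used pairs is degenerate
  let H : V → V → Prop := fun x y => G.Adj x y ∨ cherryRel P x y
  have hHdeg : IsDegenerateOn H B ⌊k⌋₊ := by
    refine isDegenerateOn_of_adjPairs_le fun W hW hWne => ?_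
    have h1 : adjPairs H W ≤ adjPairs G.Adj W + adjPairs (cherryRel P) W := by
      unfold adjPairs
      rw [← Finset.sum_add_distrib]
      refine Finset.sum_le_sum fun x _ => (Finset.card_le_card ?_).trans (Finset.card_union_le _ _)
      intro y hy
      obtain ⟨hyW, h | h⟩ := mem_relNbrs.1 hy
      · exact Finset.mem_union_left _ (mem_relNbrs.2 ⟨hyW, h⟩)
      · exact Finset.mem_union_right _ (mem_relNbrs.2 ⟨hyW, h⟩)
    have h2 : (adjPairs H W : ℝ) ≤ adjPairs G.Adj W + 2 * (P.filter fun q => q.2 ⊆ W).card := by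
      exact_mod_cast h1.trans (Nat.add_le_add_left (adjPairs_cherryRel_le hP.card_eq W) _)
    have h3 := hfew W hW hWne
    have h4 := hD W hW
    have hWpos : (0 : ℝ) < W.card := by exact_mod_cast hWne.card_pos
    have h5 : (adjPairs H W : ℝ) < ((⌊k⌋₊ + 1 : ℕ) : ℝ) * W.card := by
      have h6 := Nat.lt_floor_add_one k
      push_cast
      calc (adjPairs H W : ℝ) ≤ (D + 2 * μ) * W.card := by linarith
        _ ≤ k * W.card := mul_le_mul_of_nonneg_right hkD hWpos.le
        _ < _ := mul_lt_mul_of_pos_right h6 hWpos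
    exact_mod_cast h5
  obtain ⟨β, hβcard, hβsub, hβ⟩ := hHdeg.exists_orientation (fun x y h =>
    h.imp (fun h => h.symm) (fun h => cherryRel_symm h))
  have hβk : ∀ b, ((β b).card : ℝ) ≤ k := fun b =>
    le_trans (by exact_mod_cast hβcard b) (Nat.floor_le (by linarith))
  -- the neighbours that `a` can still use form a clique of `H`
  let U : V → Finset V := fun a =>
    (relNbrs G.Adj B a).filter fun b => (P.filter fun q => q.1 = a ∧ b ∈ q.2).card < r
  have hUB : ∀ a, ∀ x ∈ U a, x ∈ B ∧ G.Adj a x := fun a x hx =>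
    mem_relNbrs.1 (Finset.mem_filter.1 hx).1
  have hclique : ∀ a ∈ A, ∀ x ∈ U a, ∀ y ∈ U a, x ≠ y → H x y := by
    intro a ha x hx y hy hxy
    by_contra hH
    have hadj : ¬ G.Adj x y := fun h => hH (Or.inl h)
    have hnot : ∀ q ∈ P, q.2 ≠ {x, y} := fun q hq h => hH (Or.inr ⟨hxy, q, hq, h⟩)
    have hmem : ∀ z ∈ ({x, y} : Finset V), z ∈ U a := by
      intro z hz
      rcases Finset.mem_insert.1 hz with rfl | hz
      · exact hx
      · rw [Finset.mem_singleton.1 hz]; exact hy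
    have hgood : insert (a, {x, y}) P ∈ (A ×ˢ B.powerset).powerset.filter Good := by
      refine Finset.mem_filter.2 ⟨?_, ⟨?_, ?_, ?_, ?_, ?_⟩, ?_⟩
      · refine Finset.mem_powerset.2 (Finset.insert_subset ?_ (Finset.mem_powerset.1 hPsub))
        exact Finset.mem_product.2 ⟨ha, Finset.mem_powerset.2 fun z hz => (hUB a z (hmem z hz)).1⟩
      · intro q hq
        rcases Finset.mem_insert.1 hq with rfl | hq
        · exact fun z hz => (hUB a z (hmem z hz)).1
        · exact hP.subset q hq
      · intro q hq
        rcases Finset.mem_insert.1 hq with rfl | hq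
        · exact Finset.card_pair hxy
        · exact hP.card_eq q hq
      · intro q hq
        rcases Finset.mem_insert.1 hq with rfl | hq
        · exact fun z hz => (hUB a z (hmem z hz)).2
        · exact hP.adj q hq
      · intro q hq
        rcases Finset.mem_insert.1 hq with rfl | hq
        · intro z hz w hw
          simp only [Finset.mem_insert, Finset.mem_singleton] at hz hw
          rcases hz with rfl | rfl <;> rcases hw with rfl | rfl
          · exact G.loopless.irrefl _
          · exact hadj
          · exact fun h => hadj h.symm
          · exact G.loopless.irrefl _
        · exact hP.not_adj q hq
      · intro q hq q' hq' he
        rcases Finset.mem_insert.1 hq with rfl | hq <;>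
          rcases Finset.mem_insert.1 hq' with rfl | hq'
        · rfl
        · exact absurd he.symm (hnot q' hq')
        · exact absurd he (hnot q hq)
        · exact hP.unique q hq q' hq' he
      · intro a' b
        rw [Finset.filter_insert]
        split_ifs with h
        · refine (Finset.card_insert_le _ _).trans ?_
          have h1 := (Finset.mem_filter.1 (hmem b h.2)).2
          rw [← show a = a' from h.1]
          omega
        · exact hPr a' b
    have hle := hPmax.2 hgood (Finset.subset_insert _ _)
    exact hnot _ (hle (Finset.mem_insert_self _ _)) rfl
  -- at least half of the vertices of `A` have a large such clique
  let A' := A.filter fun a => δ / 2 ≤ (U a).card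
  have hsat : ∀ a ∈ A, ¬ δ / 2 ≤ (U a).card →
      r * δ / 4 ≤ ((P.filter fun q => q.1 = a).card : ℝ) := by
    intro a ha hU
    set X := (relNbrs G.Adj B a).filter fun b =>
      ¬ (P.filter fun q => q.1 = a ∧ b ∈ q.2).card < r with hX
    have h1 : (U a).card + X.card = (relNbrs G.Adj B a).card :=
      Finset.card_filter_add_card_filter_not _
    have h2 : δ / 2 ≤ X.card := by
      have h3 : ((U a).card : ℝ) + X.card = (relNbrs G.Adj B a).card := by exact_mod_cast h1
      have := hdeg a ha
      linarith
    have h3 : X.card * r ≤ 2 * (P.filter fun q => q.1 = a).card := by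
      calc X.card * r = ∑ _b ∈ X, r := by simp
        _ ≤ ∑ b ∈ X, (P.filter fun q => q.1 = a ∧ b ∈ q.2).card :=
          Finset.sum_le_sum fun b hb => not_lt.1 (Finset.mem_filter.1 hb).2
        _ = ∑ b ∈ X, ∑ q ∈ P.filter (fun q => q.1 = a), if b ∈ q.2 then 1 else 0 := by
          refine Finset.sum_congr rfl fun b _ => ?_
          rw [← Finset.filter_filter, Finset.card_filter]
        _ = ∑ q ∈ P.filter (fun q => q.1 = a), (X.filter fun b => b ∈ q.2).card := by
          rw [Finset.sum_comm]
          exact Finset.sum_congr rfl fun q _ => (Finset.card_filter _ _).symm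
        _ ≤ ∑ q ∈ P.filter (fun q => q.1 = a), 2 := by
          refine Finset.sum_le_sum fun q hq => ?_
          rw [← hP.card_eq q (Finset.mem_filter.1 hq).1]
          exact Finset.card_le_card fun b hb => (Finset.mem_filter.1 hb).2
        _ = _ := by simp [mul_comm]
    have h4 : (X.card : ℝ) * r ≤ 2 * (P.filter fun q => q.1 = a).card := by exact_mod_cast h3
    have h5 : δ / 2 * r ≤ X.card * r := mul_le_mul_of_nonneg_right h2 (Nat.cast_nonneg _)
    linarith
  have hδ0 : 0 < δ := by
    have : 0 < 16 * k / Λ := by positivity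
    linarith
  have hA' : (A.card : ℝ) / 2 ≤ A'.card := by
    by_contra hlt
    push Not at hlt
    set X := A.filter fun a => ¬ δ / 2 ≤ (U a).card with hX
    have h1 : A'.card + X.card = A.card := Finset.card_filter_add_card_filter_not _
    have h1' : (A'.card : ℝ) + X.card = A.card := by exact_mod_cast h1
    have h2 : (X.card : ℝ) * (r * δ / 4) ≤ P.card := by
      rw [← nsmul_eq_mul]
      calc X.card • (r * δ / 4) ≤ ∑ a ∈ X, ((P.filter fun q => q.1 = a).card : ℝ) :=
            Finset.card_nsmul_le_sum _ _ _ fun a ha =>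
              hsat a (Finset.mem_filter.1 ha).1 (Finset.mem_filter.1 ha).2
        _ ≤ P.card := by
            have : ∑ a ∈ X, (P.filter fun q => q.1 = a).card ≤ P.card := by
              rw [← Finset.card_biUnion]
              · exact Finset.card_le_card (Finset.biUnion_subset.2 fun a _ =>
                  Finset.filter_subset _ _)
              · intro a _ b _ hab
                refine Finset.disjoint_left.2 fun q hq hq' => hab ?_
                exact (Finset.mem_filter.1 hq).2.symm.trans (Finset.mem_filter.1 hq').2
            exact_mod_cast this
    have h3 := hfew B subset_rfl hB
    rw [Finset.filter_true_of_mem hP.subset] at h3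
    have hBpos : (0 : ℝ) < B.card := by exact_mod_cast hB.card_pos
    have hrpos : (0 : ℝ) < r := by exact_mod_cast hr
    have h4 : μ * B.card ≤ r * δ / 8 * (ρ * B.card) := by
      calc μ * B.card ≤ r * δ * ρ / 8 * B.card := mul_le_mul_of_nonneg_right hμ hBpos.le
        _ = _ := by ring
    have h5 : r * δ / 8 * (ρ * B.card) ≤ r * δ / 8 * A.card :=
      mul_le_mul_of_nonneg_left hAB (by positivity)
    have h6 : (A.card : ℝ) / 2 * (r * δ / 4) ≤ X.card * (r * δ / 4) :=
      mul_le_mul_of_nonneg_right (by linarith) (by positivity)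
    linarith
  -- count the edges between `β b` and the set of those `a` for which `b ∈ U a`
  have hupper : ∑ a ∈ A', ∑ b ∈ U a, ((β b ∩ U a).card : ℝ) ≤
      8 * k / Λ * ∑ a ∈ A', ((U a).card : ℝ) + B.card * (4 * k ^ 2 / Λ) := by
    have h1 : ∑ a ∈ A', ∑ b ∈ U a, ((β b ∩ U a).card : ℝ) ≤
        ∑ b ∈ B, ∑ a ∈ A'.filter (fun a => b ∈ U a), ((relNbrs G.Adj (β b) a).card : ℝ) := by
      rw [Finset.sum_comm' (s' := fun a => U a) (t' := A') (s := B)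
        (t := fun b => A'.filter fun a => b ∈ U a)]
      · refine Finset.sum_le_sum fun a _ => Finset.sum_le_sum fun b _ => ?_
        exact_mod_cast Finset.card_le_card fun x hx => mem_relNbrs.2
          ⟨(Finset.mem_inter.1 hx).1, (hUB a x (Finset.mem_inter.1 hx).2).2⟩
      · intro b a
        simp only [Finset.mem_filter]
        exact ⟨fun h => ⟨h.2.2, h.2.1⟩, fun h => ⟨(hUB a b h.1).1, h.2, h.1⟩⟩
    have h2 : ∑ b ∈ B, ∑ a ∈ A'.filter (fun a => b ∈ U a), ((relNbrs G.Adj (β b) a).card : ℝ) ≤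
        ∑ b ∈ B, (((A'.filter fun a => b ∈ U a).card : ℝ) * (8 * k / Λ) + 4 * k ^ 2 / Λ) :=
      Finset.sum_le_sum fun b _ => sum_relNbrs_le_of_sparse hk hΛ hsparse (hβk b)
    have h3 : ∑ b ∈ B, ((A'.filter fun a => b ∈ U a).card : ℝ) = ∑ a ∈ A', ((U a).card : ℝ) := by
      simp only [Finset.card_eq_sum_ones, Nat.cast_sum]
      refine Finset.sum_comm' fun b a => ?_
      simp only [Finset.mem_filter]
      exact ⟨fun h => ⟨h.2.2, h.2.1⟩, fun h => ⟨(hUB a b h.1).1, h.2, h.1⟩⟩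
    rw [Finset.sum_add_distrib, ← Finset.sum_mul, h3, Finset.sum_const, nsmul_eq_mul] at h2
    linarith
  have hlower : ∀ a ∈ A', δ ^ 2 / 16 + 8 * k / Λ * (U a).card ≤
      ∑ b ∈ U a, ((β b ∩ U a).card : ℝ) := by
    intro a ha
    obtain ⟨haA, hUa⟩ := Finset.mem_filter.1 ha
    have h1 := card_mul_card_le_sum_orientation (U := U a) (β := β) fun x hx y hy hxy =>
      hβ x (hUB a x hx).1 y (hUB a y hy).1 (hclique a haA x hx y hy hxy)
    have h2 : ((U a).card : ℝ) * (U a).card ≤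
        (U a).card + 2 * ∑ b ∈ U a, ((β b ∩ U a).card : ℝ) := by exact_mod_cast h1
    set u := ((U a).card : ℝ)
    have h3 : u * (1 + 16 * k / Λ) ≤ u * (u / 2) :=
      mul_le_mul_of_nonneg_left (by linarith) (by linarith)
    have h4 : (δ / 2) ^ 2 ≤ u ^ 2 := pow_le_pow_left₀ (by linarith) hUa 2
    have h5 : u * (1 + 16 * k / Λ) = u + 2 * (8 * k / Λ * u) := by ring
    nlinarith
  have hsum := Finset.sum_le_sum hlower
  rw [Finset.sum_add_distrib, Finset.sum_const, nsmul_eq_mul, ← Finset.mul_sum] at hsum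
  have hBpos : (0 : ℝ) < B.card := by exact_mod_cast hB.card_pos
  have h1 : (A'.card : ℝ) * (δ ^ 2 / 16) ≤ B.card * (4 * k ^ 2 / Λ) := by linarith
  have h2 : ρ * B.card / 2 * (δ ^ 2 / 16) ≤ A'.card * (δ ^ 2 / 16) :=
    mul_le_mul_of_nonneg_right (by linarith) (by positivity)
  have h3 : B.card * (ρ * δ ^ 2 / 32) ≤ B.card * (4 * k ^ 2 / Λ) := by linarith
  have h4 : ρ * δ ^ 2 / 32 ≤ 4 * k ^ 2 / Λ := le_of_mul_le_mul_left h3 hBpos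
  rw [le_div_iff₀ hΛ] at h4
  nlinarith

/-! ### Counting edges and conflicts -/

/-- The number of pairs `(x, y)` with `x ∈ X`, `y ∈ Y` related by `R`. -/
noncomputable def arcs {V : Type*} (R : V → V → Prop) (X Y : Finset V) : ℕ :=
  ∑ x ∈ X, (relNbrs R Y x).card

theorem arcs_self {V : Type*} (R : V → V → Prop) (X : Finset V) : arcs R X X = adjPairs R X := rfl

theorem arcs_comm {V : Type*} (G : SimpleGraph V) (X Y : Finset V) :
    arcs G.Adj X Y = arcs G.Adj Y X := by
  classical
  simp only [arcs, relNbrs, Finset.card_filter]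
  rw [Finset.sum_comm]
  refine Finset.sum_congr rfl fun y _ => Finset.sum_congr rfl fun x _ => ?_
  simp only [G.adj_comm]

theorem adjPairs_union {V : Type*} [DecidableEq V] (G : SimpleGraph V) {X Y : Finset V}
    (h : Disjoint X Y) :
    adjPairs G.Adj (X ∪ Y) = adjPairs G.Adj X + 2 * arcs G.Adj X Y + adjPairs G.Adj Y := by
  have h1 : ∀ v, (relNbrs G.Adj (X ∪ Y) v).card =
      (relNbrs G.Adj X v).card + (relNbrs G.Adj Y v).card := by
    classical
    intro v
    rw [← Finset.card_union_of_disjoint]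
    · congr 1
      ext x
      simp only [mem_relNbrs, Finset.mem_union]
      tauto
    · exact h.mono (relNbrs_subset _ _ _) (relNbrs_subset _ _ _)
  rw [← arcs_self, arcs, Finset.sum_union h]
  simp only [h1, Finset.sum_add_distrib]
  have h2 := arcs_comm G X Y
  unfold arcs at h2
  unfold arcs adjPairs
  omega

theorem adjPairs_le_sq {V : Type*} (R : V → V → Prop) (W : Finset V) :
    adjPairs R W ≤ W.card ^ 2 := by
  refine (Finset.sum_le_card_nsmul _ _ W.card fun x _ => ?_).trans (by simp [sq])
  exact Finset.card_le_card (relNbrs_subset _ _ _)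

theorem IsCherrySystem.card_centre_le {V : Type*} [DecidableEq V] {G : SimpleGraph V} {B : Finset V}
    {P : Finset (V × Finset V)} (hP : IsCherrySystem G B P) {r : ℕ}
    (hr : ∀ a b, (P.filter fun q => q.1 = a ∧ b ∈ q.2).card ≤ r) (a : V) :
    (P.filter fun q => q.1 = a).card ≤ (relNbrs G.Adj B a).card * r := by
  have h1 : (P.filter fun q => q.1 = a) ⊆ (relNbrs G.Adj B a).biUnion fun b =>
      P.filter fun q => q.1 = a ∧ b ∈ q.2 := by
    intro q hq
    obtain ⟨hqP, rfl⟩ := Finset.mem_filter.1 hq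
    obtain ⟨b, hb⟩ : q.2.Nonempty := by
      rw [← Finset.card_pos, hP.card_eq q hqP]; norm_num
    exact Finset.mem_biUnion.2 ⟨b, mem_relNbrs.2 ⟨hP.subset q hqP hb, hP.adj q hqP b hb⟩,
      Finset.mem_filter.2 ⟨hqP, rfl, hb⟩⟩
  refine (Finset.card_le_card h1).trans (Finset.card_biUnion_le.trans ?_)
  exact (Finset.sum_le_card_nsmul _ _ r fun b _ => hr a b).trans (by simp)

open scoped Classical in
/-- Conflicts between members that share an end point, counted from the first member. -/
theorem IsCherrySystem.card_conflicts_le_of_orientation {V : Type*} {G : SimpleGraph V}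
    {B : Finset V} {P : Finset (V × Finset V)} (hP : IsCherrySystem G B P) {r : ℕ}
    (hr : ∀ a b, (P.filter fun q => q.1 = a ∧ b ∈ q.2).card ≤ r) {β : V → Finset V} {k : ℕ}
    (hβ : ∀ v, (β v).card ≤ k) :
    ((centreConflicts β P).filter fun z => ¬ Disjoint z.1.2 z.2.2).card ≤
      P.card * (k * (2 * r)) := by
  have h1 : (centreConflicts β P).filter (fun z => ¬ Disjoint z.1.2 z.2.2) ⊆
      P.biUnion fun q => (β q.1).biUnion fun a => q.2.biUnion fun b =>
        (P.filter fun q' => q'.1 = a ∧ b ∈ q'.2).image fun q' => (q, q') := by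
    rintro ⟨q, q'⟩ hz
    obtain ⟨hz, hdis⟩ := Finset.mem_filter.1 hz
    obtain ⟨hz, hqq⟩ := Finset.mem_filter.1 hz
    obtain ⟨hq, hq'⟩ := Finset.mem_product.1 hz
    obtain ⟨b, hb, hb'⟩ := Finset.not_disjoint_iff.1 hdis
    refine Finset.mem_biUnion.2 ⟨q, hq, Finset.mem_biUnion.2 ⟨q'.1, hqq,
      Finset.mem_biUnion.2 ⟨b, hb, Finset.mem_image.2 ⟨q', ?_, rfl⟩⟩⟩⟩
    exact Finset.mem_filter.2 ⟨hq', rfl, hb'⟩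
  refine (Finset.card_le_card h1).trans (Finset.card_biUnion_le.trans ?_)
  refine (Finset.sum_le_card_nsmul _ _ (k * (2 * r)) fun q hq => ?_).trans (by simp)
  refine Finset.card_biUnion_le.trans ?_
  refine (Finset.sum_le_card_nsmul _ _ (2 * r) fun a _ => ?_).trans
    (by rw [smul_eq_mul]; exact Nat.mul_le_mul_right _ (hβ _))
  refine Finset.card_biUnion_le.trans ?_
  refine (Finset.sum_le_card_nsmul _ _ r fun b _ => ?_).trans (by rw [hP.card_eq q hq]; simp)
  exact Finset.card_image_le.trans (hr a b)

open scoped Classical in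
/-- Conflicts between members that share an end point `b`, counted by the edges inside the
neighbourhood of `b`. -/
theorem IsCherrySystem.card_conflicts_le_of_triangles {V : Type*} {G : SimpleGraph V}
    {A B : Finset V} {P : Finset (V × Finset V)} (hP : IsCherrySystem G B P)
    (hPA : ∀ q ∈ P, q.1 ∈ A) {r : ℕ}
    (hr : ∀ a b, (P.filter fun q => q.1 = a ∧ b ∈ q.2).card ≤ r) {β : V → Finset V}
    (hβ : ∀ v, ∀ x ∈ β v, G.Adj v x) :
    ((centreConflicts β P).filter fun z => ¬ Disjoint z.1.2 z.2.2).card ≤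
      ∑ b ∈ B, adjPairs G.Adj (relNbrs G.Adj A b) * (r * r) := by
  have h1 : (centreConflicts β P).filter (fun z => ¬ Disjoint z.1.2 z.2.2) ⊆
      B.biUnion fun b => (relNbrs G.Adj A b).biUnion fun a =>
        (relNbrs G.Adj (relNbrs G.Adj A b) a).biUnion fun a' =>
          (P.filter fun q => q.1 = a ∧ b ∈ q.2) ×ˢ (P.filter fun q => q.1 = a' ∧ b ∈ q.2) := by
    rintro ⟨q, q'⟩ hz
    obtain ⟨hz, hdis⟩ := Finset.mem_filter.1 hz
    obtain ⟨hz, hqq⟩ := Finset.mem_filter.1 hz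
    obtain ⟨hq, hq'⟩ := Finset.mem_product.1 hz
    obtain ⟨b, hb, hb'⟩ := Finset.not_disjoint_iff.1 hdis
    refine Finset.mem_biUnion.2 ⟨b, hP.subset q hq hb, Finset.mem_biUnion.2 ⟨q.1,
      mem_relNbrs.2 ⟨hPA q hq, (hP.adj q hq b hb).symm⟩, Finset.mem_biUnion.2 ⟨q'.1,
      mem_relNbrs.2 ⟨mem_relNbrs.2 ⟨hPA q' hq', (hP.adj q' hq' b hb').symm⟩, hβ _ _ hqq⟩,
      Finset.mem_product.2 ⟨Finset.mem_filter.2 ⟨hq, rfl, hb⟩,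
        Finset.mem_filter.2 ⟨hq', rfl, hb'⟩⟩⟩⟩⟩
  refine (Finset.card_le_card h1).trans (Finset.card_biUnion_le.trans ?_)
  refine Finset.sum_le_sum fun b _ => Finset.card_biUnion_le.trans ?_
  rw [adjPairs, Finset.sum_mul]
  refine Finset.sum_le_sum fun a _ => Finset.card_biUnion_le.trans ?_
  refine (Finset.sum_le_card_nsmul _ _ (r * r) fun a' _ => ?_).trans (by simp)
  rw [Finset.card_product]
  exact Nat.mul_le_mul (hr a b) (hr a' b)

/-! ### Subgraphs of maximal density -/

section MaximalDensity

variable {V : Type*} {G : SimpleGraph V} {V₀ : Finset V} {D : ℝ} {lam T : ℕ}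

/-- The almost regular case: if half of the edges of a densest subgraph are spanned by vertices
whose degree is not much larger than the average degree, then there is a long induced cycle. -/
theorem exists_long_cycle_of_almost_regular (hT : 1 ≤ T) (hlam : 2 ^ 20 * T ≤ lam)
    (hlamD : (lam : ℝ) ≤ D) (hV₀ : V₀.Nonempty)
    (hD : ∀ W : Finset V, (adjPairs G.Adj W : ℝ) ≤ D * W.card)
    (hsparse : ∀ y : ℝ, D ≤ y → ∀ W : Finset V, (W.card : ℝ) ≤ y →
      adjPairs G.Adj W * (lam : ℝ) ^ 14 ≤ y ^ 2)
    {β : V → Finset V} (hβcard : ∀ v, ((β v).card : ℝ) ≤ D) (hβadj : ∀ v, ∀ x ∈ β v, G.Adj v x)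
    (hβ : ∀ x ∈ V₀, ∀ y ∈ V₀, G.Adj x y → y ∈ β x ∨ x ∈ β y)
    {A₀ : Finset V} (hA₀V : A₀ ⊆ V₀)
    (hA₀deg : ∀ a ∈ A₀, ((relNbrs G.Adj A₀ a).card : ℝ) ≤ D * lam)
    (hA₀ : D * V₀.card / 2 ≤ adjPairs G.Adj A₀) :
    ∃ n, T + 2 ≤ n ∧ (SimpleGraph.cycleGraph (2 * n)).IsIndContained G := by
  classical
  have hT' : (1 : ℝ) ≤ T := by exact_mod_cast hT
  have hl : (2 : ℝ) ^ 20 * T ≤ lam := by exact_mod_cast hlam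
  set l : ℝ := (lam : ℝ) with hldef
  have hl0 : (2 : ℝ) ^ 20 ≤ l := by linarith
  have hlpos : 0 < l := by linarith
  have hl1 : 1 ≤ l := by linarith
  have hDpos : 0 < D := by linarith
  have hn : (0 : ℝ) < V₀.card := by exact_mod_cast hV₀.card_pos
  have hAn : (A₀.card : ℝ) ≤ V₀.card := by exact_mod_cast Finset.card_le_card hA₀V
  -- the vertices of degree at least `D / 4` are still a fraction `1 / (4 l)` of all
  let A := A₀.filter fun a => D / 4 ≤ (relNbrs G.Adj A₀ a).card
  have hA : (V₀.card : ℝ) / 4 ≤ l * A.card := by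
    have h1 : (adjPairs G.Adj A₀ : ℝ) ≤ A.card * (D * l) + V₀.card * (D / 4) := by
      rw [adjPairs, Nat.cast_sum, ← Finset.sum_filter_add_sum_filter_not A₀
        fun a => D / 4 ≤ (relNbrs G.Adj A₀ a).card]
      refine add_le_add ?_ ?_
      · rw [← nsmul_eq_mul]
        exact Finset.sum_le_card_nsmul _ _ _ fun a ha => hA₀deg a (Finset.mem_filter.1 ha).1
      · refine (Finset.sum_le_card_nsmul _ _ (D / 4) fun a ha =>
          (not_le.1 (Finset.mem_filter.1 ha).2).le).trans ?_
        rw [nsmul_eq_mul]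
        refine mul_le_mul_of_nonneg_right (le_trans ?_ hAn) (by positivity)
        exact_mod_cast Finset.card_filter_le _ _
    refine le_of_mul_le_mul_left (a := D) ?_ hDpos
    linarith
  have hA₀ne : A₀.Nonempty := by
    rw [Finset.nonempty_iff_ne_empty]
    rintro rfl
    have : (0 : ℝ) < D * V₀.card / 2 := by positivity
    simp [adjPairs] at hA₀
    linarith
  obtain ⟨B, hBA₀, hBne, P, hP, hPA, hPr, hPcard⟩ := exists_isCherrySystem (G := G) (A := A)
    (B := A₀) hA₀ne (r := lam ^ 6) (Nat.one_le_pow _ _ (by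
      have : 0 < 2 ^ 20 * T := by positivity
      omega)) (δ := D / 32) (ρ := 1 / (4 * l)) (D := D) (μ := l ^ 5 * D / 1024)
    (k := l ^ 6 * D) (Λ := l ^ 14) (by positivity)
    (by
      have : 1 ≤ l ^ 6 := one_le_pow₀ hl1
      nlinarith)
    (fun a ha => by
      have := (Finset.mem_filter.1 ha).2
      linarith)
    (by
      rw [one_div, inv_mul_le_iff₀ (by positivity)]
      linarith)
    (fun W _ => hD W)
    (by
      have h1 : l ^ 5 * 1 ≤ l ^ 5 * l := mul_le_mul_of_nonneg_left hl1 (by positivity)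
      have h2 : 1 ≤ l ^ 5 := one_le_pow₀ hl1
      have h3 : 2 * l ^ 5 ≤ l ^ 6 := by
        calc 2 * l ^ 5 ≤ l * l ^ 5 := mul_le_mul_of_nonneg_right (by linarith) (by positivity)
          _ = _ := by ring
      have h4 : 2 * l ^ 5 * D ≤ l ^ 6 * D := mul_le_mul_of_nonneg_right h3 hDpos.le
      have h5 : 1 * D ≤ l ^ 5 * D := mul_le_mul_of_nonneg_right h2 hDpos.le
      nlinarith)
    (by
      intro W hW
      have h2 : 1 * D ≤ l ^ 6 * D := mul_le_mul_of_nonneg_right (one_le_pow₀ hl1) hDpos.le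
      refine (hsparse (2 * (l ^ 6 * D)) (by linarith) W hW).trans (le_of_eq (by ring)))
    (by
      rw [Nat.cast_pow, ← hldef]
      refine le_of_eq ?_
      field_simp
      ring)
    (by
      have h1 : 16 * (l ^ 6 * D) / l ^ 14 = 16 / l ^ 8 * D := by field_simp
      have h2 : 16 / l ^ 8 ≤ 1 / 256 := by
        rw [div_le_div_iff₀ (by positivity) (by norm_num)]
        have : l ≤ l ^ 8 := le_self_pow₀ hl1 (by norm_num)
        linarith
      have h3 : 16 / l ^ 8 * D ≤ 1 / 256 * D := mul_le_mul_of_nonneg_right h2 hDpos.le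
      rw [h1]
      linarith)
    (by
      have h1 : l ^ 14 * (1 / (4 * l)) * (D / 32) ^ 2 = l * (l ^ 12 * D ^ 2) / 4096 := by
        field_simp; ring
      rw [h1]
      have h2 : 0 < l ^ 12 * D ^ 2 := by positivity
      nlinarith)
  have hBpos : (0 : ℝ) < B.card := by exact_mod_cast hBne.card_pos
  have hAA₀ : A ⊆ A₀ := Finset.filter_subset _ _
  have hBV : B ⊆ V₀ := hBA₀.trans hA₀V
  -- the sampling density `1 / (D l ^ 4)` is small enough for degrees up to `D l` and centres with
  -- `D l ^ 7` members, and large enough for `l ^ 5 D / 1024` members per vertex of `B`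
  refine hP.isIndContained_of_sample hBV (fun q hq => hA₀V (hAA₀ (hPA q hq))) hβcard hβadj hβ
    (Δ := D * l) (M := D * l ^ 7) (τ := D * l ^ 4 / 8) (p := 1 / (D * l ^ 4)) ?_ ?_ ?_
    (by positivity) ?_ ?_ ?_ ?_ hT ?_
  · intro q hq
    refine le_trans ?_ (hA₀deg q.1 (hAA₀ (hPA q hq)))
    exact_mod_cast Finset.card_le_card (relNbrs_mono _ hBA₀ _)
  · intro a
    by_cases ha : a ∈ A₀
    · have h1 := hP.card_centre_le hPr a
      have h2 : ((P.filter fun q => q.1 = a).card : ℝ) ≤ (relNbrs G.Adj B a).card * l ^ 6 := by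
        rw [hldef]; exact_mod_cast h1
      have h3 : ((relNbrs G.Adj B a).card : ℝ) ≤ D * l := by
        refine le_trans ?_ (hA₀deg a ha)
        exact_mod_cast Finset.card_le_card (relNbrs_mono _ hBA₀ _)
      calc _ ≤ _ := h2
        _ ≤ D * l * l ^ 6 := mul_le_mul_of_nonneg_right h3 (by positivity)
        _ = _ := by ring
    · rw [Finset.filter_false_of_mem fun q hq (h : q.1 = a) =>
        ha (h ▸ hAA₀ (hPA q hq))]
      simp only [Finset.card_empty, Nat.cast_zero]
      positivity
  · have h1 := hP.card_conflicts_le_of_triangles (A := A₀) (fun q hq => hAA₀ (hPA q hq)) hPr hβadj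
    have h2 : ∀ b ∈ B, (adjPairs G.Adj (relNbrs G.Adj A₀ b) : ℝ) * (l ^ 6 * l ^ 6) ≤ D ^ 2 := by
      intro b hb
      have h3 := hsparse (D * l) (by nlinarith) _ (hA₀deg b (hBA₀ hb))
      refine le_of_mul_le_mul_right (a := l ^ 2) ?_ (by positivity)
      calc _ = (adjPairs G.Adj (relNbrs G.Adj A₀ b) : ℝ) * l ^ 14 := by ring
        _ ≤ _ := h3
        _ = _ := by ring
    have h3 : (((centreConflicts β P).filter fun z => ¬ Disjoint z.1.2 z.2.2).card : ℝ) ≤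
        ∑ b ∈ B, (adjPairs G.Adj (relNbrs G.Adj A₀ b) : ℝ) * (l ^ 6 * l ^ 6) := by
      rw [hldef]; exact_mod_cast h1
    calc _ ≤ _ := h3
      _ ≤ B.card * D ^ 2 := by
        rw [← nsmul_eq_mul]; exact Finset.sum_le_card_nsmul _ _ _ h2
      _ ≤ D * l ^ 4 / 8 * (l ^ 5 * D / 1024 * B.card) := by
        have h4 : 8192 ≤ l ^ 9 := by
          have : l ≤ l ^ 9 := le_self_pow₀ hl1 (by norm_num)
          linarith
        have h5 : 0 < B.card * D ^ 2 := by positivity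
        have h6 : D * l ^ 4 / 8 * (l ^ 5 * D / 1024 * B.card) =
            (B.card * D ^ 2) * (l ^ 9 / 8192) := by ring
        rw [h6]
        exact le_mul_of_one_le_right h5.le (by linarith)
      _ ≤ _ := mul_le_mul_of_nonneg_left hPcard (by positivity)
  · rw [div_le_one (by positivity)]
    have : 1 ≤ l ^ 4 := one_le_pow₀ hl1
    nlinarith
  · have h1 : 1 / (D * l ^ 4) * (D * l + 2 * D) = (l + 2) / l ^ 4 := by field_simp
    rw [h1, div_le_div_iff₀ (by positivity) (by norm_num)]
    have : l ^ 2 ≤ l ^ 4 := pow_le_pow_right₀ hl1 (by norm_num)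
    nlinarith
  · have h1 : D * (D * l ^ 7) * (1 / (D * l ^ 4)) ^ 2 = 1 / l := by field_simp
    rw [h1, div_le_div_iff₀ (by positivity) (by norm_num)]
    linarith
  · refine le_of_eq ?_
    field_simp
  · have h1 : l / 1024 * B.card ≤ 1 / (D * l ^ 4) * P.card := by
      calc l / 1024 * B.card = 1 / (D * l ^ 4) * (l ^ 5 * D / 1024 * B.card) := by field_simp
        _ ≤ _ := mul_le_mul_of_nonneg_left hPcard (by positivity)
    have h2 : 4 * T < l / 1024 := by
      rw [lt_div_iff₀ (by norm_num)]
      nlinarith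
    have h3 : 4 * T * (B.card : ℝ) < l / 1024 * B.card := mul_lt_mul_of_pos_right h2 hBpos
    linarith

/-- The unbalanced case: if many edges of a densest subgraph join a set `A₀` to a much smaller
set `B`, then there is a long induced cycle. -/
theorem exists_long_cycle_of_unbalanced (hT : 1 ≤ T) (hlam : 2 ^ 20 * T ≤ lam)
    (hlamD : (lam : ℝ) ≤ D) (hV₀ : V₀.Nonempty)
    (hD : ∀ W : Finset V, (adjPairs G.Adj W : ℝ) ≤ D * W.card)
    (hsparse : ∀ y : ℝ, D ≤ y → ∀ W : Finset V, (W.card : ℝ) ≤ y →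
      adjPairs G.Adj W * (lam : ℝ) ^ 14 ≤ y ^ 2)
    {β : V → Finset V} (hβcard : ∀ v, ((β v).card : ℝ) ≤ D) (hβadj : ∀ v, ∀ x ∈ β v, G.Adj v x)
    (hβ : ∀ x ∈ V₀, ∀ y ∈ V₀, G.Adj x y → y ∈ β x ∨ x ∈ β y)
    {A₀ B : Finset V} (hA₀V : A₀ ⊆ V₀) (hBV : B ⊆ V₀) (hdisj : Disjoint A₀ B)
    (hBcard : (B.card : ℝ) * lam ≤ V₀.card)
    (hAB : D * V₀.card / 8 ≤ arcs G.Adj A₀ B) :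
    ∃ n, T + 2 ≤ n ∧ (SimpleGraph.cycleGraph (2 * n)).IsIndContained G := by
  classical
  have hT' : (1 : ℝ) ≤ T := by exact_mod_cast hT
  have hl : (2 : ℝ) ^ 20 * T ≤ lam := by exact_mod_cast hlam
  set l : ℝ := (lam : ℝ) with hldef
  have hl0 : (2 : ℝ) ^ 20 ≤ l := by linarith
  have hlpos : 0 < l := by linarith
  have hl1 : 1 ≤ l := by linarith
  have hDpos : 0 < D := by linarith
  have hn : (0 : ℝ) < V₀.card := by exact_mod_cast hV₀.card_pos
  have hAn : (A₀.card : ℝ) ≤ V₀.card := by exact_mod_cast Finset.card_le_card hA₀V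
  have hBn : (B.card : ℝ) * 2 ^ 20 ≤ V₀.card :=
    le_trans (mul_le_mul_of_nonneg_left hl0 (Nat.cast_nonneg _)) hBcard
  let d : V → ℝ := fun a => ((relNbrs G.Adj B a).card : ℝ)
  let Ahi := A₀.filter fun a => 2 * D < d a
  let A := (A₀.filter fun a => ¬ 2 * D < d a).filter fun a => D / 32 ≤ d a
  have hAA₀ : A ⊆ A₀ := (Finset.filter_subset _ _).trans (Finset.filter_subset _ _)
  -- by maximality of the density, few edges leave vertices of exceptionally high degree
  have hhi : ∑ a ∈ Ahi, d a ≤ D * B.card := by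
    have h1 : (Ahi.card : ℝ) * (2 * D) ≤ ∑ a ∈ Ahi, d a := by
      rw [← nsmul_eq_mul]
      exact Finset.card_nsmul_le_sum _ _ _ fun a ha => (Finset.mem_filter.1 ha).2.le
    have h2 : Disjoint Ahi B := hdisj.mono_left (Finset.filter_subset _ _)
    have h3 := hD (Ahi ∪ B)
    rw [adjPairs_union G h2, Finset.card_union_of_disjoint h2] at h3
    have h4 : ((arcs G.Adj Ahi B : ℕ) : ℝ) = ∑ a ∈ Ahi, d a := by
      simp only [arcs, d, Nat.cast_sum]
    push_cast at h3
    rw [h4] at h3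
    have h5 : (0 : ℝ) ≤ adjPairs G.Adj Ahi := Nat.cast_nonneg _
    have h6 : (0 : ℝ) ≤ adjPairs G.Adj B := Nat.cast_nonneg _
    have h7 : (0 : ℝ) ≤ B.card := Nat.cast_nonneg _
    nlinarith
  have hA : (V₀.card : ℝ) / 32 ≤ A.card := by
    have h1 : ((arcs G.Adj A₀ B : ℕ) : ℝ) = ∑ a ∈ A₀, d a := by
      simp only [arcs, d, Nat.cast_sum]
    rw [h1, ← Finset.sum_filter_add_sum_filter_not A₀ fun a => 2 * D < d a,
      ← Finset.sum_filter_add_sum_filter_not (A₀.filter fun a => ¬ 2 * D < d a)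
        fun a => D / 32 ≤ d a] at hAB
    have h2 : ∑ a ∈ A, d a ≤ A.card * (2 * D) := by
      rw [← nsmul_eq_mul]
      exact Finset.sum_le_card_nsmul _ _ _ fun a ha =>
        not_lt.1 (Finset.mem_filter.1 (Finset.mem_filter.1 ha).1).2
    have h3 : ∑ a ∈ (A₀.filter fun a => ¬ 2 * D < d a).filter (fun a => ¬ D / 32 ≤ d a), d a ≤
        V₀.card * (D / 32) := by
      refine (Finset.sum_le_card_nsmul _ _ (D / 32) fun a ha =>
        (not_le.1 (Finset.mem_filter.1 ha).2).le).trans ?_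
      rw [nsmul_eq_mul]
      refine mul_le_mul_of_nonneg_right (le_trans ?_ hAn) (by positivity)
      exact_mod_cast (Finset.card_filter_le _ _).trans (Finset.card_filter_le _ _)
    have h4 : D * (B.card * 2 ^ 20) ≤ D * V₀.card := mul_le_mul_of_nonneg_left hBn hDpos.le
    refine le_of_mul_le_mul_left (a := D) ?_ hDpos
    change _ ≤ ∑ a ∈ Ahi, d a + (∑ a ∈ A, d a + _) at hAB
    nlinarith
  have hBne : B.Nonempty := by
    rw [Finset.nonempty_iff_ne_empty]
    rintro rfl
    have : (0 : ℝ) < D * V₀.card / 8 := by positivity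
    simp [arcs, relNbrs] at hAB
    linarith
  obtain ⟨B₀, hB₀B, hB₀ne, P, hP, hPA, hPr, hPcard⟩ := exists_isCherrySystem (G := G) (A := A)
    (B := B) hBne (r := 1) le_rfl (δ := D / 32) (ρ := l / 32) (D := D) (μ := l * D / 8192)
    (k := l * D) (Λ := l ^ 14) (by positivity) (by nlinarith)
    (fun a ha => (Finset.mem_filter.1 ha).2)
    (by linarith)
    (fun W _ => hD W)
    (by nlinarith)
    (by
      intro W hW
      refine (hsparse (2 * (l * D)) (by nlinarith) W hW).trans (le_of_eq (by ring)))
    (by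
      refine le_of_eq ?_
      push_cast
      ring)
    (by
      have h1 : 16 * (l * D) / l ^ 14 = 16 / l ^ 13 * D := by field_simp
      have h2 : 16 / l ^ 13 ≤ 1 / 256 := by
        rw [div_le_div_iff₀ (by positivity) (by norm_num)]
        have : l ≤ l ^ 13 := le_self_pow₀ hl1 (by norm_num)
        linarith
      have h3 : 16 / l ^ 13 * D ≤ 1 / 256 * D := mul_le_mul_of_nonneg_right h2 hDpos.le
      rw [h1]
      linarith)
    (by
      have h1 : l ^ 14 * (l / 32) * (D / 32) ^ 2 = l ^ 13 / 32768 * (l ^ 2 * D ^ 2) := by ring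
      have h2 : 128 * (l * D) ^ 2 = 128 * (l ^ 2 * D ^ 2) := by ring
      rw [h1, h2]
      refine mul_lt_mul_of_pos_right ?_ (by positivity)
      rw [lt_div_iff₀ (by norm_num)]
      have : l ^ 2 ≤ l ^ 13 := pow_le_pow_right₀ hl1 (by norm_num)
      nlinarith)
  have hBpos : (0 : ℝ) < B₀.card := by exact_mod_cast hB₀ne.card_pos
  have hdA : ∀ a ∈ A, ((relNbrs G.Adj B₀ a).card : ℝ) ≤ 2 * D := by
    intro a ha
    refine le_trans ?_ (not_lt.1 (Finset.mem_filter.1 (Finset.mem_filter.1 ha).1).2)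
    change _ ≤ ((relNbrs G.Adj B a).card : ℝ)
    exact_mod_cast Finset.card_le_card (relNbrs_mono _ hB₀B _)
  refine hP.isIndContained_of_sample (hB₀B.trans hBV) (fun q hq => hA₀V (hAA₀ (hPA q hq)))
    hβcard hβadj hβ (Δ := 2 * D) (M := 2 * D) (τ := 2 * D) (p := 1 / (16 * D)) ?_ ?_ ?_
    (by positivity) ?_ ?_ ?_ ?_ hT ?_
  · exact fun q hq => hdA q.1 (hPA q hq)
  · intro a
    by_cases ha : a ∈ A
    · refine le_trans ?_ (hdA a ha)
      have h1 := hP.card_centre_le hPr a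
      rw [mul_one] at h1
      exact_mod_cast h1
    · rw [Finset.filter_false_of_mem fun q hq (h : q.1 = a) => ha (h ▸ hPA q hq)]
      simp only [Finset.card_empty, Nat.cast_zero]
      positivity
  · have h1 := hP.card_conflicts_le_of_orientation hPr (β := β) (k := ⌊D⌋₊)
      fun v => Nat.le_floor (hβcard v)
    have h2 : (((centreConflicts β P).filter fun z => ¬ Disjoint z.1.2 z.2.2).card : ℝ) ≤
        P.card * (⌊D⌋₊ * (2 * 1)) := by exact_mod_cast h1
    have h3 : (⌊D⌋₊ : ℝ) ≤ D := Nat.floor_le hDpos.le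
    have h4 : (P.card : ℝ) * (⌊D⌋₊ * (2 * 1)) ≤ P.card * (D * (2 * 1)) := by gcongr
    linarith
  · rw [div_le_one (by positivity)]
    linarith
  · refine le_of_eq_of_le (b := 1 / 4) ?_ (by norm_num)
    field_simp
    norm_num
  · refine le_of_eq_of_le (b := 1 / 128) ?_ (by norm_num)
    field_simp
    norm_num
  · refine le_of_eq ?_
    field_simp
    norm_num
  · have h1 : l / 131072 * B₀.card ≤ 1 / (16 * D) * P.card := by
      calc l / 131072 * B₀.card = 1 / (16 * D) * (l * D / 8192 * B₀.card) := by
            field_simp; norm_num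
        _ ≤ _ := mul_le_mul_of_nonneg_left hPcard (by positivity)
    have h2 : 4 * T < l / 131072 := by
      rw [lt_div_iff₀ (by norm_num)]
      nlinarith
    have h3 : 4 * T * (B₀.card : ℝ) < l / 131072 * B₀.card := mul_lt_mul_of_pos_right h2 hBpos
    linarith

/-- A densest subgraph of large average degree `D`, in which moderately large sets are sparse,
contains a long induced cycle: the vertices whose degree is much larger than `D` either miss half
of the edges, or form a small set that meets half of the edges. -/
theorem exists_long_cycle_of_densest (hT : 1 ≤ T) (hlam : 2 ^ 20 * T ≤ lam)
    (hlamD : (lam : ℝ) ≤ D) (hV₀ : V₀.Nonempty)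
    (hD : ∀ W : Finset V, (adjPairs G.Adj W : ℝ) ≤ D * W.card)
    (hDV : (adjPairs G.Adj V₀ : ℝ) = D * V₀.card)
    (hsparse : ∀ y : ℝ, D ≤ y → ∀ W : Finset V, (W.card : ℝ) ≤ y →
      adjPairs G.Adj W * (lam : ℝ) ^ 14 ≤ y ^ 2) :
    ∃ n, T + 2 ≤ n ∧ (SimpleGraph.cycleGraph (2 * n)).IsIndContained G := by
  classical
  have hT' : (1 : ℝ) ≤ T := by exact_mod_cast hT
  have hl : (2 : ℝ) ^ 20 * T ≤ lam := by exact_mod_cast hlam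
  have hl0 : (2 : ℝ) ^ 20 ≤ lam := by linarith
  have hDpos : 0 < D := by linarith
  have hn : (0 : ℝ) < V₀.card := by exact_mod_cast hV₀.card_pos
  have hdeg : IsDegenerateOn G.Adj V₀ ⌊D⌋₊ := by
    refine isDegenerateOn_of_adjPairs_le fun W _ hWne => ?_
    have hWpos : (0 : ℝ) < W.card := by exact_mod_cast hWne.card_pos
    have h1 : (adjPairs G.Adj W : ℝ) < ((⌊D⌋₊ + 1 : ℕ) : ℝ) * W.card := by
      refine (hD W).trans_lt (mul_lt_mul_of_pos_right ?_ hWpos)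
      push_cast
      exact Nat.lt_floor_add_one D
    exact_mod_cast h1
  obtain ⟨β, hβcard, hβsub, hβ⟩ := hdeg.exists_orientation fun x y h => h.symm
  have hβD : ∀ v, ((β v).card : ℝ) ≤ D := fun v =>
    le_trans (by exact_mod_cast hβcard v) (Nat.floor_le hDpos.le)
  let B := V₀.filter fun v => D * lam < (relNbrs G.Adj V₀ v).card
  let A₀ := V₀.filter fun v => ¬ D * lam < (relNbrs G.Adj V₀ v).card
  have hdisj : Disjoint A₀ B := (Finset.disjoint_filter_filter_not V₀ V₀ _).symm
  have hunion : A₀ ∪ B = V₀ := by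
    rw [Finset.union_comm]; exact Finset.filter_union_filter_not_eq _ _
  have hBcard : (B.card : ℝ) * lam ≤ V₀.card := by
    refine le_of_mul_le_mul_left (a := D) ?_ hDpos
    rw [← hDV]
    calc D * (B.card * lam) = B.card • (D * lam) := by rw [nsmul_eq_mul]; ring
      _ ≤ ∑ v ∈ B, ((relNbrs G.Adj V₀ v).card : ℝ) :=
        Finset.card_nsmul_le_sum _ _ _ fun v hv => (Finset.mem_filter.1 hv).2.le
      _ ≤ _ := by
        unfold adjPairs
        exact_mod_cast Finset.sum_le_sum_of_subset (Finset.filter_subset _ _)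
  by_cases hcase : D * V₀.card / 2 ≤ adjPairs G.Adj A₀
  · refine exists_long_cycle_of_almost_regular hT hlam hlamD hV₀ hD hsparse hβD
      (fun v x hx => (hβsub v x hx).2) hβ (Finset.filter_subset _ _) (fun a ha => ?_) hcase
    refine le_trans ?_ (not_lt.1 (Finset.mem_filter.1 ha).2)
    exact_mod_cast Finset.card_le_card (relNbrs_mono _ (Finset.filter_subset _ _) _)
  · refine exists_long_cycle_of_unbalanced hT hlam hlamD hV₀ hD hsparse hβD
      (fun v x hx => (hβsub v x hx).2) hβ (Finset.filter_subset _ _) (Finset.filter_subset _ _)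
      hdisj hBcard ?_
    have h1 := adjPairs_union G hdisj
    rw [hunion] at h1
    have h2 : (adjPairs G.Adj V₀ : ℝ) =
        adjPairs G.Adj A₀ + 2 * arcs G.Adj A₀ B + adjPairs G.Adj B := by exact_mod_cast h1
    have h3 := hD B
    have h4 : (B.card : ℝ) * 2 ^ 20 ≤ V₀.card :=
      le_trans (mul_le_mul_of_nonneg_left hl0 (Nat.cast_nonneg _)) hBcard
    have h5 : D * (B.card * 2 ^ 20) ≤ D * V₀.card := mul_le_mul_of_nonneg_left h4 hDpos.le
    have h6 : 0 < D * V₀.card := by positivity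
    push Not at hcase
    linarith

end MaximalDensity

/-! ### Polynomial degeneracy and the chromatic number -/

/-- In a graph without long induced cycles and without `K_{Λ,Λ}`, sets of at most `y` vertices span
few edges, once `y` is large. -/
theorem NoBiclique.adjPairs_mul_le {V : Type*} {G : SimpleGraph V} {Λ t : ℕ}
    (h : NoBiclique G Λ) (hΛ : 1 ≤ Λ) (hG : G.CycleGEFree t) {y : ℝ}
    (hy : (8 * Λ : ℝ) ^ ((t + 3) ^ 2 + 3 * (t + 3) + 11) ≤ y) {W : Finset V}
    (hW : (W.card : ℝ) ≤ y) : adjPairs G.Adj W * (Λ : ℝ) ≤ y ^ 2 := by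
  have hΛ' : (1 : ℝ) ≤ Λ := by exact_mod_cast hΛ
  set e := (t + 3) ^ 2 + 3 * (t + 3) + 10 with he
  by_cases hbig : (8 * Λ) ^ e ≤ W.card
  · have h1 : adjPairs G.Adj W * Λ < W.card ^ 2 := by
      by_contra hcon
      exact hG (2 * (t + 3)) (by omega) (by omega)
        (h.isIndContained_of_dense hΛ hbig (not_lt.1 hcon))
    have h2 : (adjPairs G.Adj W : ℝ) * Λ ≤ (W.card : ℝ) ^ 2 := by exact_mod_cast h1.le
    exact h2.trans (pow_le_pow_left₀ (Nat.cast_nonneg _) hW 2)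
  · have h1 : (W.card : ℝ) ≤ (8 * Λ : ℝ) ^ e := by exact_mod_cast (not_le.1 hbig).le
    have h2 : (adjPairs G.Adj W : ℝ) ≤ (W.card : ℝ) ^ 2 := by exact_mod_cast adjPairs_le_sq _ _
    have h3 : (W.card : ℝ) ^ 2 ≤ ((8 * Λ : ℝ) ^ e) ^ 2 :=
      pow_le_pow_left₀ (Nat.cast_nonneg _) h1 2
    calc (adjPairs G.Adj W : ℝ) * Λ ≤ ((8 * Λ : ℝ) ^ e) ^ 2 * (8 * Λ) ^ 2 := by
          refine mul_le_mul (h2.trans h3) ?_ (by positivity) (by positivity)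
          nlinarith
      _ = ((8 * Λ : ℝ) ^ (e + 1)) ^ 2 := by ring
      _ ≤ y ^ 2 := pow_le_pow_left₀ (by positivity) hy 2

/-- Graphs without long induced cycles and without `K_{ℓ,ℓ}` have degeneracy polynomial in `ℓ`. -/
theorem isDegenerateOn_of_cycleGEFree {V : Type*} [Fintype V] {G : SimpleGraph V} {t ℓ : ℕ}
    (hℓ : 2 ≤ ℓ) (hG : G.CycleGEFree t) (hbi : NoBiclique G ℓ) :
    IsDegenerateOn G.Adj Finset.univ
      (ℓ ^ ((3 + 14 * (20 + t)) * ((t + 3) ^ 2 + 3 * (t + 3) + 11))) := by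
  classical
  set e := (t + 3) ^ 2 + 3 * (t + 3) + 11 with he
  set c := 20 + t with hc
  intro W₁ _ hW₁ne
  by_contra hcon
  push Not at hcon
  -- a densest subgraph
  obtain ⟨V₀, hV₀, hmax⟩ := Finset.exists_max_image
    ((Finset.univ : Finset (Finset V)).filter Finset.Nonempty)
    (fun W => (adjPairs G.Adj W : ℝ) / W.card) ⟨W₁, Finset.mem_filter.2 ⟨Finset.mem_univ _, hW₁ne⟩⟩
  have hV₀ne : V₀.Nonempty := (Finset.mem_filter.1 hV₀).2
  set D : ℝ := (adjPairs G.Adj V₀ : ℝ) / V₀.card with hDdef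
  have hVpos : (0 : ℝ) < V₀.card := by exact_mod_cast hV₀ne.card_pos
  have hDle : ∀ W : Finset V, W.Nonempty → (adjPairs G.Adj W : ℝ) / W.card ≤ D := fun W hW =>
    hmax W (Finset.mem_filter.2 ⟨Finset.mem_univ _, hW⟩)
  have hD : ∀ W : Finset V, (adjPairs G.Adj W : ℝ) ≤ D * W.card := by
    intro W
    rcases W.eq_empty_or_nonempty with rfl | hW
    · simp [adjPairs]
    · have hWpos : (0 : ℝ) < W.card := by exact_mod_cast hW.card_pos
      exact (div_le_iff₀ hWpos).1 (hDle W hW)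
  have hDlarge : (ℓ : ℝ) ^ ((3 + 14 * c) * e) ≤ D := by
    refine le_trans ?_ (hDle W₁ hW₁ne)
    have hWpos : (0 : ℝ) < W₁.card := by exact_mod_cast hW₁ne.card_pos
    rw [le_div_iff₀ hWpos, mul_comm, ← nsmul_eq_mul, adjPairs, Nat.cast_sum]
    exact Finset.card_nsmul_le_sum _ _ _ fun v hv => by exact_mod_cast (hcon v hv).le
  have hℓ' : (2 : ℝ) ≤ ℓ := by exact_mod_cast hℓ
  have hℓ1 : (1 : ℝ) ≤ ℓ := by linarith
  have hlam : 2 ^ 20 * (t + 1) ≤ ℓ ^ c := by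
    calc 2 ^ 20 * (t + 1) ≤ 2 ^ 20 * 2 ^ t := Nat.mul_le_mul_left _ Nat.lt_two_pow_self
      _ = 2 ^ c := by rw [hc, pow_add]
      _ ≤ _ := Nat.pow_le_pow_left hℓ c
  have h8 : (8 * ((ℓ ^ c) ^ 14 : ℕ) : ℝ) ^ e ≤ D := by
    refine le_trans ?_ hDlarge
    rw [pow_mul]
    refine pow_le_pow_left₀ (by positivity) ?_ e
    rw [← pow_mul, mul_comm c 14, Nat.cast_pow, pow_add]
    refine mul_le_mul_of_nonneg_right ?_ (by positivity)
    calc (8 : ℝ) = 2 ^ 3 := by norm_num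
      _ ≤ _ := pow_le_pow_left₀ (by norm_num) hℓ' 3
  have hbi' : NoBiclique G ((ℓ ^ c) ^ 14) := hbi.mono (by
    rw [← pow_mul]; exact Nat.le_self_pow (by omega) ℓ)
  obtain ⟨n, hn, hcyc⟩ := exists_long_cycle_of_densest (G := G) (V₀ := V₀) (D := D) (lam := ℓ ^ c)
    (T := t + 1) (by omega) hlam
    (by
      refine le_trans ?_ hDlarge
      push_cast
      refine pow_le_pow_right₀ hℓ1 ?_
      nlinarith)
    hV₀ne hD (by rw [hDdef, div_mul_cancel₀ _ hVpos.ne'])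
    (by
      intro y hy W hW
      have := hbi'.adjPairs_mul_le (Nat.one_le_pow _ _ (Nat.pow_pos (by omega))) hG (h8.trans hy) hW
      simpa using this)
  exact hG (2 * n) (by omega) (by omega) hcyc

theorem corollary4 :
    ∃ f : ℕ → ℕ, ∀ (t ℓ : ℕ) (V : Type*) [Finite V] (G : SimpleGraph V),
      G.CycleGEFree t →
      (completeBipartiteGraph (Fin ℓ) (Fin ℓ)).Free G →
      G.chromaticNumber ≤ ((ℓ ^ f t + 1 : ℕ) : ℕ∞) := by
  refine ⟨fun t => (3 + 14 * (20 + t)) * ((t + 3) ^ 2 + 3 * (t + 3) + 11), ?_⟩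
  intro t ℓ V _ G hG hfree
  have := Fintype.ofFinite V
  have hbi := noBiclique_of_free hfree
  rw [SimpleGraph.chromaticNumber_le_iff_colorable]
  rcases lt_or_ge ℓ 2 with hℓ | hℓ
  · -- for `ℓ = 0` there is no such graph, for `ℓ = 1` there are no edges
    have hdeg : IsDegenerateOn G.Adj (Finset.univ : Finset V) 0 := by
      intro W _ hW
      obtain ⟨v, hv⟩ := hW
      refine ⟨v, hv, ?_⟩
      by_contra hcon
      obtain ⟨x, hx⟩ := Finset.card_pos.1 (Nat.pos_of_ne_zero fun h => hcon h.le)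
      have := hbi {v} {x} (by simpa using (mem_relNbrs.1 hx).2)
      simp only [Finset.card_singleton] at this
      omega
    exact hdeg.colorable.mono (by omega)
  · exact (isDegenerateOn_of_cycleGEFree hℓ hG hbi).colorable
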